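/- Let $n\ge 1$, $k=\lfloor (n+1)/2\rfloor$ (so $n=2k-1$ or $n=2k$) and $q_1,\dots,q_k\in(0,1)$. A symplectic Gelfand–Tsetlin pattern with $n$ rows is an array $x=(x^1,\dots,x^n)$ of nonnegative integers, where row $x^r$ has $\lfloor (r+1)/2\rfloor$ entries, such that $x^{2i-1}_1\le x^{2i}_1\le x^{2i-1}_2\le x^{2i}_2\le\cdots\le x^{2i-1}_i\le x^{2i}_i$ and $x^{2i+1}_1\le x^{2i}_1\le x^{2i+1}_2\le\cdots\le x^{2i}_i\le x^{2i+1}_{i+1}$ for all rows that occur. Let $\mathbb K^0_n$ be the set of these patterns and $\mathcal W^k_0=\{z\in\mathbb Z^k:0\le z_1\le\cdots\le z_k\}$. With $|x^r|$ the sum of row $r$ and $|x^0|=0$, put $$w_n(x)=\prod_{1\le r\le n,\ r=2i-1} q_i^{|x^{r}|-|x^{r-1}|}\ \prod_{1\le r\le n,\ r=2i} q_i^{|x^{r-1}|-|x^{r}|},\qquad Sp^n_z(q)=\sum_{x\in\mathbb K^0_n,\ x^n=z}w_n(x)\quad(z\in\mathcal W^k_0),$$ and let $M^n_z(x)=w_n(x)/Sp^n_z(q)$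 if $x^n=z$ and $M^n_z(x)=0$ otherwise, a probability distribution on $\mathbb K^0_n$. Let $(\mathfrak X(t);t\ge0)$ be the continuous-time Markov process on $\mathbb K^0_n$ with the following jump rates. Each particle (entry) of row $2i-1$ attempts to jump one step to the right at rate $q_i$ and one step to the left at rate $q_i^{-1}$; each particle of row $2i$ attempts to jump to the right at rate $q_i^{-1}$ and to the left at rate $q_i$; all attempts are independent. An attempted jump is suppressed (blocked) if it would violate an interlacing inequality with the row above, or if it is a left jump from the origin. When a particle jumps and this would violate an interlacing inequality with a particle of the row below, that particle is pushed one step in the same direction; a pushed particle in turn pushes in the same way in the next row, and so on. Define $Q_n$ on $\mathcal W^k_0\times\mathcal W^k_0$ by $$Q_n(x,x\pm e_i)=\frac{Sp^n_{x\pm e_i}(q)}{Sp^n_x(q)}\qquad\text{whenever } x,\,x\pm e_i\in\mathcal W^k_0,\ 1\le i\le k,$$ all other off-diagonal entries being $0$, and $$-Q_{2k-1}(x,x)=\sum_{i=1}^{k-1}(q_i+q_i^{-1})+q_k^{-1}\mathbf 1_{[x_1>0]}+q_k,\qquad -Q_{2k}(x,x)=\sum_{i=1}^{k}(q_i+q_i^{-1}).$$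 Then $Q_n$ is a conservative $Q$-matrix (nonnegative off-diagonal entries and zero row sums), and for every $z\in\mathcal W^k_0$, if $\mathfrak X(0)$ has distribution $M^n_z$, then the bottom row $(\mathfrak X^n(t);t\ge0)$ is distributed as a Markov process with $Q$-matrix $Q_n$ started from $z$. -/

import Mathlib

open scoped NNReal

namespace SymplecticGT

/-! ### Continuous-time Markov processes with a given `Q`-matrix on a discrete state space -/

/-- `Q` is a conservative `Q`-matrix: its off-diagonal entries are nonnegative and each of its rows
sums to `0`. -/
structure IsConservative {S : Type*} (Q : S → S → ℝ) : Prop where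
  nonneg : ∀ x y, x ≠ y → 0 ≤ Q x y
  hasSum_zero : ∀ x, HasSum (Q x) 0

open scoped Classical in
/-- `P` is an (honest, standard) transition function on the discrete space `S` whose matrix of
derivatives at time `0` is `Q`. -/
structure IsTransitionFunction {S : Type*} (Q : S → S → ℝ) (P : ℝ≥0 → S → S → ℝ) : Prop where
  nonneg : ∀ t x y, 0 ≤ P t x y
  hasSum_one : ∀ t x, HasSum (P t x) 1
  zero : ∀ x y, P 0 x y = if x = y then 1 else 0
  chapman_kolmogorov : ∀ s t x y, HasSum (fun z => P s x z * P t z y) (P (s + t) x y)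
  deriv_zero : ∀ x y,
    Filter.Tendsto (fun t : ℝ≥0 => (P t x y - P 0 x y) / (t : ℝ)) (nhdsWithin 0 (Set.Ioi 0))
      (nhds (Q x y))

/-- `(X t)_{t ≥ 0}` is, under `μ`, a time-homogeneous Markov process on the discrete space `S` with
`Q`-matrix `Q` and initial distribution `ν` (a probability mass function): its
finite-dimensional distributions are
`μ (X 0 = s₀, X t₁ = s₁, …, X t_N = s_N) = ν s₀ * P_{t₁} s₀ s₁ * ⋯ * P_{t_N - t_{N-1}} s_{N-1} s_N`
for a transition function `P` with `Q`-matrix `Q`. -/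
def IsMarkovProcess {S Ω : Type*} [MeasurableSpace Ω] (μ : MeasureTheory.Measure Ω)
    (X : ℝ≥0 → Ω → S) (Q : S → S → ℝ) (ν : S → ℝ) : Prop :=
  (∀ t s, MeasurableSet {ω | X t ω = s}) ∧
  ∃ P : ℝ≥0 → S → S → ℝ, IsTransitionFunction Q P ∧
    ∀ (N : ℕ) (t : Fin (N + 1) → ℝ≥0) (s : Fin (N + 1) → S), Monotone t → t 0 = 0 →
      μ {ω | ∀ i, X (t i) ω = s i} =
        ENNReal.ofReal (ν (s 0) *
          ∏ i : Fin N, P (t i.succ - t i.castSucc) (s i.castSucc) (s i.succ))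

/-! ### Symplectic Gelfand–Tsetlin patterns -/

/-- The positions `(r, i)` in a pattern with `n` rows: row `r ∈ {1, …, n}` has the
`⌊(r + 1) / 2⌋` positions `i = 1, …, ⌊(r + 1) / 2⌋`. -/
def positions (n : ℕ) : Finset (ℕ × ℕ) :=
  {p ∈ Finset.Icc 1 n ×ˢ Finset.Icc 1 n | p.2 ≤ (p.1 + 1) / 2}

/-- A particle of a pattern with `n` rows. -/
abbrev Particle (n : ℕ) : Type := {p : ℕ × ℕ // p ∈ positions n}

/-- The row of a particle, from `1` to `n`. -/
def Particle.row {n : ℕ} (p : Particle n) : ℕ := p.1.1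

/-- The index of a particle within its row, counted from `1`. -/
def Particle.idx {n : ℕ} (p : Particle n) : ℕ := p.1.2

/-- `b` is the particle of the next row that is the right neighbour of `a`:
`(r, i)` has right neighbour `(r + 1, i)` if `r` is odd and `(r + 1, i + 1)` if `r` is even. -/
def RightBelow {n : ℕ} (a b : Particle n) : Prop :=
  b.row = a.row + 1 ∧ b.idx = a.idx + (a.row + 1) % 2

/-- `b` is the particle of the next row that is the left neighbour of `a`:
`(r, i)` has left neighbour `(r + 1, i - 1)` if `r` is odd (none if `i = 1`) and `(r + 1, i)` if
`r` is even. -/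
def LeftBelow {n : ℕ} (a b : Particle n) : Prop :=
  b.row = a.row + 1 ∧ b.idx + a.row % 2 = a.idx

/-- Integer-valued symplectic Gelfand–Tsetlin patterns with `n` rows. With `x` an odd row and `y`
the even row below it the interlacing reads `x₁ ≤ y₁ ≤ x₂ ≤ y₂ ≤ ⋯ ≤ x_k ≤ y_k`; with `x` an even
row and `y` the odd row below it, it reads `y₁ ≤ x₁ ≤ y₂ ≤ ⋯ ≤ x_k ≤ y_{k+1}`. -/
structure IsPattern {n : ℕ} (x : Particle n → ℤ) : Prop where
  nonneg : ∀ a, 0 ≤ x a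
  le_right : ∀ a b, RightBelow a b → x a ≤ x b
  left_le : ∀ a b, LeftBelow a b → x b ≤ x a

/-- The space of symplectic Gelfand–Tsetlin patterns with `n` rows. -/
abbrev Pattern (n : ℕ) : Type := {x : Particle n → ℤ // IsPattern x}

/-- The chamber `0 ≤ z₁ ≤ z₂ ≤ ⋯ ≤ z_k` in `ℤ^k` (`z_i` is written `z ⟨i - 1, _⟩`). -/
abbrev Chamber (k : ℕ) : Type := {z : Fin k → ℤ // Monotone z ∧ ∀ i, 0 ≤ z i}

theorem mem_positions {n r i : ℕ} :
    (r, i) ∈ positions n ↔ 1 ≤ r ∧ r ≤ n ∧ 1 ≤ i ∧ i ≤ (r + 1) / 2 := by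
  simp only [positions, Finset.mem_filter, Finset.mem_product, Finset.mem_Icc]
  omega

/-- The `(i + 1)`-st particle of the bottom row `n`, for `i = 0, …, ⌊(n + 1) / 2⌋ - 1`. -/
def bottomParticle (n : ℕ) (i : Fin ((n + 1) / 2)) : Particle n :=
  ⟨(n, (i : ℕ) + 1), mem_positions.2 (by have := i.2; omega)⟩

theorem Pattern.monotone_bottom {n : ℕ} (x : Pattern n) :
    Monotone fun i => x.1 (bottomParticle n i) := by
  have key : ∀ (d : ℕ) (i j : Fin ((n + 1) / 2)), (j : ℕ) = i + d →
      x.1 (bottomParticle n i) ≤ x.1 (bottomParticle n j) := by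
    intro d
    induction d with
    | zero =>
      intro i j h
      have : j = i := Fin.ext (by simpa using h)
      rw [this]
    | succ d ih =>
      intro i j h
      have hj := j.2
      have h1 := ih i ⟨i + d, by omega⟩ rfl
      refine h1.trans ?_
      let a : Particle n := ⟨(n - 1, (j : ℕ) + (n + 1) % 2), mem_positions.2 (by omega)⟩
      have h2 := x.2.left_le a (bottomParticle n ⟨i + d, by omega⟩)
        ⟨by simp only [a, bottomParticle, Particle.row]; omega, by
          simp only [a, bottomParticle, Particle.row, Particle.idx]; omega⟩
      have h3 := x.2.le_right a (bottomParticle n j)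
        ⟨by simp only [a, bottomParticle, Particle.row]; omega, by
          simp only [a, bottomParticle, Particle.row, Particle.idx]; omega⟩
      exact h2.trans h3
  intro i j hij
  exact key (j - i) i j (by have : (i : ℕ) ≤ j := hij; omega)

/-- The bottom row of a pattern with `n` rows, a point of the chamber in `ℤ^k`,
`k = ⌊(n + 1) / 2⌋`. -/
def bottomRow {n : ℕ} (x : Pattern n) : Chamber ((n + 1) / 2) :=
  ⟨fun i => x.1 (bottomParticle n i), x.monotone_bottom, fun _ => x.2.nonneg _⟩

/-! ### Symplectic Schur functions

The parameters are `q 1, …, q k` with `k = ⌊(n + 1) / 2⌋`; the other values of `q` play no role. -/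

/-- The sum of the entries in row `r` (equal to `0` for `r = 0`). -/
def rowSum {n : ℕ} (x : Pattern n) (r : ℕ) : ℤ :=
  ∑ p : Particle n with p.row = r, x.1 p

/-- The geometric weight of a pattern: an odd row `r = 2 i - 1` contributes
`q_i ^ (|x^r| - |x^(r-1)|)` and an even row `r = 2 i` contributes `q_i ^ (|x^(r-1)| - |x^r|)`. -/
noncomputable def weight {n : ℕ} (q : ℕ → ℝ) (x : Pattern n) : ℝ :=
  ∏ r ∈ Finset.Icc 1 n,
    q ((r + 1) / 2) ^ (if Odd r then rowSum x r - rowSum x (r - 1)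
      else rowSum x (r - 1) - rowSum x r)

/-- The symplectic Schur function: the (finite) sum of the weights of all patterns with bottom
row `z`. -/
noncomputable def Sp (n : ℕ) (q : ℕ → ℝ) (z : Chamber ((n + 1) / 2)) : ℝ :=
  ∑' x : {x : Pattern n // bottomRow x = z}, weight q x.1

open scoped Classical in
/-- The distribution on patterns with bottom row `z` that is proportional to the weight. -/
noncomputable def initialLaw (n : ℕ) (q : ℕ → ℝ) (z : Chamber ((n + 1) / 2)) (x : Pattern n) : ℝ :=
  if bottomRow x = z then weight q x / Sp n q z else 0

open scoped Classical in
/-- The `Q`-matrix on the chamber in `ℤ^k`, `k = ⌊(n + 1) / 2⌋`. Here `Pi.single i 1` is the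
standard basis vector. In the diagonal entry for odd `n`, the condition is that the first
coordinate of `x` is positive. -/
noncomputable def rowQ (n : ℕ) (q : ℕ → ℝ) (x y : Chamber ((n + 1) / 2)) : ℝ :=
  if x = y then
    if Odd n then
      -((∑ i ∈ Finset.Icc 1 ((n + 1) / 2 - 1), (q i + (q i)⁻¹))
        + (if ∃ i : Fin ((n + 1) / 2), (i : ℕ) = 0 ∧ 0 < x.1 i then (q ((n + 1) / 2))⁻¹ else 0)
        + q ((n + 1) / 2))
    else
      -∑ i ∈ Finset.Icc 1 ((n + 1) / 2), (q i + (q i)⁻¹)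
  else if ∃ i, y.1 = x.1 + Pi.single i 1 ∨ y.1 = x.1 - Pi.single i 1 then
    Sp n q y / Sp n q x
  else 0

/-! ### Dynamics on patterns with a wall at the origin -/

/-- The rate at which a particle attempts to jump right: `q_i` on row `2 i - 1`, `q_i⁻¹` on row
`2 i`. -/
noncomputable def rightRate {n : ℕ} (q : ℕ → ℝ) (a : Particle n) : ℝ :=
  if Odd a.row then q ((a.row + 1) / 2) else (q ((a.row + 1) / 2))⁻¹

/-- The rate at which a particle attempts to jump left: `q_i⁻¹` on row `2 i - 1`, `q_i` on row
`2 i`. -/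
noncomputable def leftRate {n : ℕ} (q : ℕ → ℝ) (a : Particle n) : ℝ :=
  if Odd a.row then (q ((a.row + 1) / 2))⁻¹ else q ((a.row + 1) / 2)

/-- A right jump of `a` is suppressed if the particle bounding it from the right in the row above
is at the same site. -/
def RightBlocked {n : ℕ} (x : Particle n → ℤ) (a : Particle n) : Prop :=
  ∃ c, LeftBelow c a ∧ x c = x a

/-- A left jump of `a` is suppressed if `a` is at the wall, or if the particle bounding it from the
left in the row above is at the same site. -/
def LeftBlocked {n : ℕ} (x : Particle n → ℤ) (a : Particle n) : Prop :=
  x a = 0 ∨ ∃ c, RightBelow c a ∧ x c = x a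

open scoped Classical in
/-- The configuration after a right jump of `a`: a particle that moves right pushes its right
neighbour in the next row if that one is at the same site, and so on down the rows. -/
noncomputable def jumpRight {n : ℕ} (x : Particle n → ℤ) (a : Particle n) : Particle n → ℤ :=
  fun b => if Relation.ReflTransGen (fun c d => RightBelow c d ∧ x c = x d) a b
    then x b + 1 else x b

open scoped Classical in
/-- The configuration after a left jump of `a`: a particle that moves left pushes its left
neighbour in the next row if that one is at the same site, and so on down the rows. -/
noncomputable def jumpLeft {n : ℕ} (x : Particle n → ℤ) (a : Particle n) : Particle n → ℤ :=
  fun b => if Relation.ReflTransGen (fun c d => LeftBelow c d ∧ x c = x d) a b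
    then x b - 1 else x b

open scoped Classical in
/-- The `Q`-matrix of the process of patterns: each particle attempts to jump right and left at its
own rates, independently of the others, subject to blocking and pushing. The diagonal entry is
minus the total rate of the jumps that are not suppressed. -/
noncomputable def patternQ (n : ℕ) (q : ℕ → ℝ) (x y : Pattern n) : ℝ :=
  if x = y then
    -∑ a : Particle n, ((if RightBlocked x.1 a then 0 else rightRate q a)
      + (if LeftBlocked x.1 a then 0 else leftRate q a))
  else
    ∑ a : Particle n,
      ((if ¬ RightBlocked x.1 a ∧ y.1 = jumpRight x.1 a then rightRate q a else 0)
        + (if ¬ LeftBlocked x.1 a ∧ y.1 = jumpLeft x.1 a then leftRate q a else 0))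

end SymplecticGT

/-! The proof is an intertwining argument. Write `A` for `patternQ`, `B` for `rowQ` and `K` for
`initialLaw`, viewed as a kernel from bottom rows to patterns. The heart is the identity `K A = B K`
(`isIntertwining`).

All rates are bounded, so `A` and `B` act as bounded operators on summable row vectors, and every
transition function with `Q`-matrix `A` is `exp (t A)` (`row_eq_exp`). The identity therefore passes
to the semigroups, `K exp (t A) = exp (t B) K` (`exp_lift`). Since `K z` lives on the patterns with
bottom row `z`, summing the finite-dimensional distributions over all pattern paths above a given
path of bottom rows leaves a product of entries of `exp (t B)` (`tsum_paths`).

For the identity itself, let `G r` be the right rate in row `r`, with `G (n + 1) = 1`; left rates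
are `1 / G r`. Summation by parts turns the weight into the product of `(G r / G (r + 1)) ^ |x^r|`
over the rows (`weight_eq`). A right jump started by `a` that pushes down to a last particle `b`
thus multiplies the weight by a telescoping product, and `w(y) G(row a) = w(x) G(row b + 1)`, where
`x` is the new pattern. Hence the sum over all jumps `y → x` can be indexed by the last moved
particle `b`, from which `y` is recovered by moving a chain back upwards (`sum_push`). Left jumps
are the same after negation, with `1 / G`.

If the bottom row changes, `b` lies in row `n` and contributes `G (n + 1) = 1`, which gives the
off-diagonal entries of `B` (`sum_unpush_of_ne`). If it does not change, each reversed move ending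
at `b` cancels against the exit rate of the neighbour of `b` in the next row. Only particles at the
ends of rows survive, and they give the diagonal of `B` (`sum_unpush_self`). -/

namespace SymplecticGT

/-! ### Summable functions and kernels -/

/-- The Banach space of summable real functions on `S`. -/
abbrev L1 (S : Type*) : Type _ := lp (fun _ : S => ℝ) 1

namespace L1

variable {S T F : Type*} [NormedAddCommGroup F] [NormedSpace ℝ F]

/-- A summable function as an element of `L1 S`. -/
def ofSummable (f : S → ℝ) (hf : Summable f) : L1 S :=
  ⟨f, memℓp_gen (by simpa using hf.abs)⟩

theorem hasSum_norm (f : L1 S) : HasSum (fun s => |f s|) ‖f‖ := by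
  simpa using lp.hasSum_norm (p := 1) (by simp) f

theorem norm_eq_tsum (f : L1 S) : ‖f‖ = ∑' s, |f s| := (hasSum_norm f).tsum_eq.symm

theorem summable (f : L1 S) : Summable f := (hasSum_norm f).summable.of_abs

open scoped Classical in
/-- The unit mass at `s`. -/
noncomputable def dirac (s : S) : L1 S := lp.single 1 s 1

open scoped Classical in
theorem dirac_apply (s t : S) : dirac s t = if s = t then 1 else 0 := by
  simp only [dirac, lp.single_apply, Pi.single_apply, eq_comm]

theorem hasSum_dirac (f : L1 S) : HasSum (fun s => f s • dirac s) f := by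
  classical
  convert lp.hasSum_single (p := 1) (by simp) f using 2 with s
  rw [dirac, ← lp.single_smul, smul_eq_mul, mul_one]

theorem hasSum_clm (L : L1 S →L[ℝ] F) (f : L1 S) :
    HasSum (fun s => f s • L (dirac s)) (L f) := by
  simpa using (hasSum_dirac f).mapL L

theorem clm_ext {L M : L1 S →L[ℝ] F} (h : ∀ s, L (dirac s) = M (dirac s)) : L = M := by
  ext f
  exact (hasSum_clm L f).unique (by simpa only [h] using hasSum_clm M f)

theorem summable_smul {F : Type*} [NormedAddCommGroup F] [NormedSpace ℝ F] [CompleteSpace F]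
    {C : ℝ} {k : S → F} (hk : ∀ s, ‖k s‖ ≤ C) (f : L1 S) : Summable fun s => f s • k s := by
  refine Summable.of_norm_bounded ((hasSum_norm f).summable.mul_right C) fun s => ?_
  rw [norm_smul, Real.norm_eq_abs]
  exact mul_le_mul_of_nonneg_left (hk s) (abs_nonneg _)

theorem norm_hasSum_smul_le [CompleteSpace F] {C : ℝ} {k : S → F} (hk : ∀ s, ‖k s‖ ≤ C) (f : L1 S)
    {v : F} (hv : HasSum (fun s => f s • k s) v) : ‖v‖ ≤ C * ‖f‖ := by
  rw [← hv.tsum_eq, mul_comm]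
  refine tsum_of_norm_bounded ((hasSum_norm f).mul_right C) fun s => ?_
  rw [norm_smul, Real.norm_eq_abs]
  exact mul_le_mul_of_nonneg_left (hk s) (abs_nonneg _)

/-- The operator `f ↦ ∑ s, f s • k s` of a bounded kernel `k`. -/
noncomputable def ofKernel [CompleteSpace F] (k : S → F) (C : ℝ) (hk : ∀ s, ‖k s‖ ≤ C) :
    L1 S →L[ℝ] F :=
  LinearMap.mkContinuous
    { toFun := fun f => ∑' s, f s • k s
      map_add' := fun f g => by
        rw [← (summable_smul hk f).tsum_add (summable_smul hk g)]
        exact tsum_congr fun s => by rw [← add_smul]; rfl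
      map_smul' := fun c f => by
        rw [RingHom.id_apply, ← (summable_smul hk f).tsum_const_smul]
        exact tsum_congr fun s => by rw [← mul_smul]; rfl }
    C fun f => norm_hasSum_smul_le hk f (summable_smul hk f).hasSum

theorem hasSum_ofKernel [CompleteSpace F] (k : S → F) (C : ℝ) (hk : ∀ s, ‖k s‖ ≤ C) (f : L1 S) :
    HasSum (fun s => f s • k s) (ofKernel k C hk f) := (summable_smul hk f).hasSum

@[simp] theorem ofKernel_dirac [CompleteSpace F] (k : S → F) (C : ℝ) (hk : ∀ s, ‖k s‖ ≤ C) (s : S) :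
    ofKernel k C hk (dirac s) = k s := by
  classical
  refine (hasSum_ofKernel k C hk _).unique ?_
  convert hasSum_ite_eq s (k s) using 2 with t
  rw [dirac_apply]
  by_cases h : s = t
  · simp [h]
  · simp [h, Ne.symm h]

theorem hasSum_apply {ι : Type*} {g : ι → L1 S} {f : L1 S} (h : HasSum g f) (s : S) :
    HasSum (fun i => g i s) (f s) :=
  h.mapL (lp.evalCLM ℝ (fun _ : S => ℝ) 1 s)

theorem tendsto_apply {ι : Type*} {l : Filter ι} {g : ι → L1 S} {f : L1 S}
    (h : Filter.Tendsto g l (nhds f)) (s : S) :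
    Filter.Tendsto (fun i => g i s) l (nhds (f s)) :=
  ((lp.evalCLM ℝ (fun _ : S => ℝ) 1 s).continuous.tendsto f).comp h

/-- Scheffé's lemma for summable families. -/
theorem tendsto_of_pointwise {ι : Type*} {l : Filter ι} [l.NeBot] {g : ι → L1 S} {f : L1 S}
    (hg : ∀ᶠ i in l, ∀ s, 0 ≤ g i s) (hf : ∀ s, 0 ≤ f s)
    (hs : Filter.Tendsto (fun i => ∑' s, g i s) l (nhds (∑' s, f s)))
    (hp : ∀ s, Filter.Tendsto (fun i => g i s) l (nhds (f s))) :
    Filter.Tendsto g l (nhds f) := by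
  rw [tendsto_iff_norm_sub_tendsto_zero]
  -- The distance is computed from `|g - f| = g + f - 2 min(g, f)`; the minimum is dominated by `f`,
  -- so its sum converges.
  have hmin : Filter.Tendsto (fun i => ∑' s, min (g i s) (f s)) l (nhds (∑' s, f s)) := by
    refine tendsto_tsum_of_dominated_convergence (summable f) (fun s => ?_) ?_
    · simpa using (hp s).min (tendsto_const_nhds (x := f s))
    · filter_upwards [hg] with i hi s
      rw [Real.norm_eq_abs, abs_of_nonneg (le_min (hi s) (hf s))]
      exact min_le_right _ _
  have := (hs.add (tendsto_const_nhds (x := ∑' s, f s))).sub (hmin.const_mul 2)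
  have h0 : (∑' s, f s) + ∑' s, f s - 2 * ∑' s, f s = 0 := by ring
  rw [h0] at this
  refine this.congr' ?_
  filter_upwards [hg] with i hi
  rw [norm_eq_tsum]
  have hm : Summable fun s => min (g i s) (f s) :=
    Summable.of_nonneg_of_le (fun s => le_min (hi s) (hf s)) (fun s => min_le_right _ _) (summable f)
  rw [← (summable (g i)).tsum_add (summable f), ← tsum_mul_left,
    ← ((summable (g i)).add (summable f)).tsum_sub (hm.mul_left 2)]
  refine tsum_congr fun s => ?_
  have h1 : (g i - f) s = g i s - f s := rfl
  rw [h1]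
  rcases le_total (g i s) (f s) with h | h
  · rw [min_eq_left h, abs_of_nonpos (by linarith)]; ring
  · rw [min_eq_right h, abs_of_nonneg (by linarith)]; ring

end L1

end SymplecticGT

namespace SymplecticGT

open Filter Topology

variable {S : Type*} {A : S → S → ℝ} {P : ℝ≥0 → S → S → ℝ}

/-! ### Bounded conservative `Q`-matrices -/

namespace IsConservative

theorem diag_nonpos (hA : IsConservative A) (x : S) : A x x ≤ 0 := by
  by_contra! h
  have h0 := le_hasSum (hA.hasSum_zero x) x fun y hy => hA.nonneg x y hy.symm
  exact absurd h0 (not_le.2 h)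

/-- A row of a conservative `Q`-matrix as a summable function. -/
def row (hA : IsConservative A) (x : S) : L1 S := L1.ofSummable (A x) (hA.hasSum_zero x).summable

@[simp] theorem row_apply (hA : IsConservative A) (x y : S) : hA.row x y = A x y := rfl

theorem norm_row (hA : IsConservative A) (x : S) : ‖hA.row x‖ = -2 * A x x := by
  classical
  rw [L1.norm_eq_tsum]
  have h : HasSum (fun y => |hA.row x y|) (0 + -2 * A x x) := by
    convert (hA.hasSum_zero x).add (hasSum_ite_eq x (-2 * A x x)) using 2 with y
    by_cases hxy : y = x
    · subst hxy
      rw [row_apply, abs_of_nonpos (hA.diag_nonpos y), if_pos rfl]; ring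
    · rw [row_apply, abs_of_nonneg (hA.nonneg x y (Ne.symm hxy)), if_neg hxy, add_zero]
  rw [h.tsum_eq, zero_add]

theorem norm_row_le (hA : IsConservative A) {c : ℝ} (hc : ∀ x, -A x x ≤ c) (x : S) :
    ‖hA.row x‖ ≤ 2 * c := by
  rw [hA.norm_row]; linarith [hc x]

/-- The operator `f ↦ f A` on row vectors. -/
noncomputable def op (hA : IsConservative A) {c : ℝ} (hc : ∀ x, -A x x ≤ c) : L1 S →L[ℝ] L1 S :=
  L1.ofKernel hA.row (2 * c) (hA.norm_row_le hc)

@[simp] theorem op_dirac (hA : IsConservative A) {c : ℝ} (hc : ∀ x, -A x x ≤ c) (x : S) :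
    hA.op hc (L1.dirac x) = hA.row x := L1.ofKernel_dirac _ _ _ _

end IsConservative

/-! ### Transition functions with bounded rates are exponentials -/

namespace IsTransitionFunction

/-- A row of a transition function as a summable function. -/
def row (hP : IsTransitionFunction A P) (t : ℝ≥0) (x : S) : L1 S :=
  L1.ofSummable (P t x) (hP.hasSum_one t x).summable

@[simp] theorem row_apply (hP : IsTransitionFunction A P) (t : ℝ≥0) (x y : S) :
    hP.row t x y = P t x y := rfl

theorem norm_row (hP : IsTransitionFunction A P) (t : ℝ≥0) (x : S) : ‖hP.row t x‖ = 1 := by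
  rw [L1.norm_eq_tsum, ← (hP.hasSum_one t x).tsum_eq]
  exact tsum_congr fun y => abs_of_nonneg (hP.nonneg t x y)

theorem row_zero (hP : IsTransitionFunction A P) (x : S) : hP.row 0 x = L1.dirac x := by
  ext y
  rw [row_apply, hP.zero, L1.dirac_apply]

theorem hasSum_row_add (hP : IsTransitionFunction A P) (s t : ℝ≥0) (x : S) :
    HasSum (fun y => P s x y • hP.row t y) (hP.row (s + t) x) := by
  have h := L1.summable_smul (k := hP.row t) (C := 1) (fun y => (hP.norm_row t y).le) (hP.row s x)
  have h' := h.hasSum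
  have e : hP.row (s + t) x = ∑' y, hP.row s x y • hP.row t y := by
    ext z
    exact (hP.chapman_kolmogorov s t x z).unique (L1.hasSum_apply h' z)
  rw [e]
  exact h'

theorem le_one (hP : IsTransitionFunction A P) (t : ℝ≥0) (x y : S) : P t x y ≤ 1 :=
  le_hasSum (hP.hasSum_one t x) y fun z _ => hP.nonneg t x z

theorem pow_diag_le (hP : IsTransitionFunction A P) (s : ℝ≥0) (x : S) (n : ℕ) :
    P s x x ^ n ≤ P (n * s) x x := by
  induction n with
  | zero => simp [hP.zero]
  | succ n ih =>
    have h := le_hasSum (hP.chapman_kolmogorov (n * s) s x x) x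
      fun z _ => mul_nonneg (hP.nonneg _ _ _) (hP.nonneg _ _ _)
    have h1 : ((n + 1 : ℕ) : ℝ≥0) * s = n * s + s := by push_cast; ring
    rw [h1, pow_succ]
    exact (mul_le_mul_of_nonneg_right ih (hP.nonneg _ _ _)).trans h

/-- Split `[0, t]` into `m` equal pieces: staying at `x` throughout gives `P t x x ≥ (P (t/m) x x) ^
m`. Bernoulli's inequality bounds this below by `1 + m (P (t/m) x x - 1)`, which tends to `1 + t * A
x x`. With bounded rates this controls the escape probability uniformly in `x`. -/
theorem diag_ge (hP : IsTransitionFunction A P) (t : ℝ≥0) (x : S) : 1 + t * A x x ≤ P t x x := by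
  rcases eq_or_ne t 0 with rfl | ht
  · simp [hP.zero]
  have hlim : Tendsto (fun n : ℕ => t / ((n : ℝ≥0) + 1)) atTop (𝓝[>] 0) := by
    refine tendsto_nhdsWithin_iff.2 ⟨?_, Eventually.of_forall fun n => ?_⟩
    · rw [← NNReal.tendsto_coe]
      simpa [div_eq_mul_inv] using
        (tendsto_one_div_add_atTop_nhds_zero_nat (𝕜 := ℝ)).const_mul (t : ℝ)
    · exact div_pos (pos_iff_ne_zero.2 ht) (by positivity)
  have hd := (((hP.deriv_zero x x).comp hlim).const_mul (t : ℝ)).const_add 1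
  refine le_of_tendsto' hd fun n => ?_
  have h1 := hP.pow_diag_le (t / ((n : ℝ≥0) + 1)) x (n + 1)
  have h2 : ((n + 1 : ℕ) : ℝ≥0) * (t / ((n : ℝ≥0) + 1)) = t := by
    push_cast; field_simp
  rw [h2] at h1
  refine le_trans ?_ h1
  set f := P (t / ((n : ℝ≥0) + 1)) x x with hf
  have h3 := one_add_mul_le_pow (a := f - 1) (by
    have := hP.nonneg (t / ((n : ℝ≥0) + 1)) x x
    rw [← hf] at this; linarith) (n + 1)
  rw [add_sub_cancel] at h3
  refine le_trans (le_of_eq ?_) h3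
  have ht' : (t : ℝ) ≠ 0 := by exact_mod_cast ht
  simp only [Function.comp_apply, hP.zero, if_true, ← hf]
  push_cast
  field_simp

variable {c : ℝ}

theorem norm_row_sub_dirac (hP : IsTransitionFunction A P) (t : ℝ≥0) (x : S) :
    ‖hP.row t x - L1.dirac x‖ = 2 * (1 - P t x x) := by
  classical
  rw [L1.norm_eq_tsum]
  have h : HasSum (fun y => |(hP.row t x - L1.dirac x) y|) (1 + (1 - 2 * P t x x)) := by
    convert (hP.hasSum_one t x).add (hasSum_ite_eq x (1 - 2 * P t x x)) using 2 with y
    have h1 : (hP.row t x - L1.dirac x) y = P t x y - L1.dirac x y := rfl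
    rw [h1, L1.dirac_apply]
    by_cases hxy : y = x
    · subst hxy
      rw [if_pos rfl, if_pos rfl, abs_of_nonpos (by linarith [hP.le_one t y y])]; ring
    · rw [if_neg (Ne.symm hxy), if_neg hxy, sub_zero, add_zero, abs_of_nonneg (hP.nonneg t x y)]
  rw [h.tsum_eq]; ring

theorem norm_row_sub_dirac_le (hP : IsTransitionFunction A P) (hc : ∀ x, -A x x ≤ c) (t : ℝ≥0)
    (x : S) : ‖hP.row t x - L1.dirac x‖ ≤ 2 * c * t := by
  rw [hP.norm_row_sub_dirac]
  have h1 := hP.diag_ge t x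
  have h2 := mul_le_mul_of_nonneg_left (hc x) t.2
  change (t : ℝ) * -A x x ≤ t * c at h2
  linarith

/-- Upgrades the entrywise derivative at `0` to a derivative in norm. Adding `c` times the unit mass
at `x` makes the difference quotients nonnegative by `diag_ge`; their total mass is the constant
`c`, so Scheffé's lemma applies. -/
theorem tendsto_row (hA : IsConservative A) (hP : IsTransitionFunction A P)
    (hc : ∀ x, -A x x ≤ c) (x : S) :
    Tendsto (fun t : ℝ≥0 => (t : ℝ)⁻¹ • (hP.row t x - L1.dirac x)) (𝓝[>] 0) (𝓝 (hA.row x)) := by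
  have e : ∀ (t : ℝ≥0) (y : S), ((t : ℝ)⁻¹ • (hP.row t x - L1.dirac x) + c • L1.dirac x) y
      = (P t x y - P 0 x y) / t + c * L1.dirac x y := by
    intro t y
    rw [← hP.row_zero x]
    change (t : ℝ)⁻¹ * (P t x y - P 0 x y) + c * P 0 x y = _ + c * P 0 x y
    rw [div_eq_inv_mul]
  have e' : ∀ y : S, (hA.row x + c • L1.dirac x) y = A x y + c * L1.dirac x y := fun y => rfl
  have hd : HasSum (L1.dirac x) 1 := by
    rw [← hP.row_zero x]; exact hP.hasSum_one 0 x
  have key : Tendsto (fun t : ℝ≥0 => (t : ℝ)⁻¹ • (hP.row t x - L1.dirac x) + c • L1.dirac x)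
      (𝓝[>] 0) (𝓝 (hA.row x + c • L1.dirac x)) := by
    refine L1.tendsto_of_pointwise ?_ ?_ ?_ ?_
    · filter_upwards [self_mem_nhdsWithin] with t ht y
      have ht' : (0 : ℝ) < t := ht
      rw [e]
      have h1 := hP.zero x y
      have h2 := hP.row_zero x
      have h3 : L1.dirac x y = P 0 x y := by rw [← h2]; rfl
      rw [h3, h1]
      by_cases hxy : x = y
      · subst hxy
        rw [if_pos rfl]
        have h4 := hP.diag_ge t x
        have h5 : -c ≤ (P t x x - 1) / t := by
          rw [le_div_iff₀ ht']
          have := mul_le_mul_of_nonneg_left (hc x) ht'.le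
          linarith
        linarith
      · rw [if_neg hxy, mul_zero, add_zero, sub_zero]
        exact div_nonneg (hP.nonneg _ _ _) ht'.le
    · intro y
      rw [e', L1.dirac_apply]
      by_cases hxy : x = y
      · subst hxy
        rw [if_pos rfl]; linarith [hc x]
      · rw [if_neg hxy, mul_zero, add_zero]
        exact hA.nonneg x y hxy
    · have h1 : ∑' y, (hA.row x + c • L1.dirac x) y = 0 + c * 1 := by
        simp_rw [e']
        exact ((hA.hasSum_zero x).add (hd.mul_left c)).tsum_eq
      rw [h1]
      refine tendsto_const_nhds.congr fun t => ?_
      simp_rw [e]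
      have h2 := (((hP.hasSum_one t x).sub (hP.hasSum_one 0 x)).div_const (t : ℝ)).add
        (hd.mul_left c)
      rw [h2.tsum_eq]; simp
    · intro y
      simp_rw [e, e']
      exact (hP.deriv_zero x y).add tendsto_const_nhds
  have := key.sub (tendsto_const_nhds (x := c • L1.dirac x))
  simpa using this

theorem hasSum_row_add_sub (hP : IsTransitionFunction A P) (s t : ℝ≥0) (x : S) :
    HasSum (fun y => P s x y • (hP.row t y - L1.dirac y)) (hP.row (s + t) x - hP.row s x) := by
  simp_rw [smul_sub]
  exact (hP.hasSum_row_add s t x).sub (L1.hasSum_dirac (hP.row s x))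

theorem norm_row_add_sub_le (hP : IsTransitionFunction A P) (hc : ∀ x, -A x x ≤ c) (s t : ℝ≥0)
    (x : S) : ‖hP.row (s + t) x - hP.row s x‖ ≤ 2 * c * t := by
  have h := L1.norm_hasSum_smul_le (fun y => hP.norm_row_sub_dirac_le hc t y) (hP.row s x)
    (hP.hasSum_row_add_sub s t x)
  rwa [hP.norm_row, mul_one] at h

/-- The forward equation: by Chapman–Kolmogorov the increment is a mixture of short-time increments,
and the uniform bound `2 * c` permits dominated convergence. -/
theorem tendsto_slope (hA : IsConservative A) (hP : IsTransitionFunction A P)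
    (hc : ∀ x, -A x x ≤ c) (s : ℝ≥0) (x : S) :
    Tendsto (fun t : ℝ≥0 => (t : ℝ)⁻¹ • (hP.row (s + t) x - hP.row s x)) (𝓝[>] 0)
      (𝓝 (hA.op hc (hP.row s x))) := by
  have h := tendsto_tsum_of_dominated_convergence (𝓕 := 𝓝[>] (0 : ℝ≥0))
    (f := fun (t : ℝ≥0) y => P s x y • ((t : ℝ)⁻¹ • (hP.row t y - L1.dirac y)))
    (g := fun y => P s x y • hA.row y) (bound := fun y => P s x y * (2 * c))
    ((hP.hasSum_one s x).summable.mul_right _) (fun y => (hP.tendsto_row hA hc y).const_smul _) (by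
      filter_upwards [self_mem_nhdsWithin] with t ht y
      have ht' : (0 : ℝ) < t := ht
      rw [norm_smul, Real.norm_eq_abs, abs_of_nonneg (hP.nonneg _ _ _)]
      refine mul_le_mul_of_nonneg_left ?_ (hP.nonneg _ _ _)
      rw [norm_smul, norm_inv, Real.norm_eq_abs, abs_of_pos ht', inv_mul_le_iff₀ ht']
      linarith [hP.norm_row_sub_dirac_le hc t y])
  have e : ∑' y, P s x y • hA.row y = hA.op hc (hP.row s x) :=
    (L1.hasSum_ofKernel hA.row (2 * c) (hA.norm_row_le hc) (hP.row s x)).tsum_eq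
  rw [e] at h
  refine h.congr fun t => ?_
  rw [← ((hP.hasSum_row_add_sub s t x).const_smul (t : ℝ)⁻¹).tsum_eq]
  exact tsum_congr fun y => smul_comm _ _ _

theorem continuous_row (hP : IsTransitionFunction A P) (hc : ∀ x, -A x x ≤ c) (x : S) :
    Continuous fun t : ℝ => hP.row t.toNNReal x := by
  have h0 : 0 ≤ 2 * c := by
    have := (norm_nonneg _).trans (hP.norm_row_sub_dirac_le hc 1 x)
    simpa using this
  have key : ∀ s t : ℝ≥0, s ≤ t → ‖hP.row t x - hP.row s x‖ ≤ 2 * c * (t - s) := by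
    intro s t hst
    obtain ⟨u, rfl⟩ := exists_add_of_le hst
    simpa using hP.norm_row_add_sub_le hc s u x
  have : LipschitzWith (Real.toNNReal (2 * c)) fun t : ℝ≥0 => hP.row t x := by
    refine LipschitzWith.of_dist_le_mul fun s t => ?_
    rw [Real.coe_toNNReal _ h0, NNReal.dist_eq, dist_eq_norm]
    rcases le_total s t with h | h
    · rw [norm_sub_rev, abs_sub_comm, abs_of_nonneg (by simpa using h)]
      exact key s t h
    · rw [abs_of_nonneg (by simpa using h)]
      exact key t s h
  exact this.continuous.comp continuous_real_toNNReal

/-- Only the right derivative is obtained; together with continuity this suffices for uniqueness of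
solutions of the linear equation. -/
theorem hasDerivWithinAt_row (hA : IsConservative A) (hP : IsTransitionFunction A P)
    (hc : ∀ x, -A x x ≤ c) (x : S) (t : ℝ) (ht : 0 ≤ t) :
    HasDerivWithinAt (fun t : ℝ => hP.row t.toNNReal x) (hA.op hc (hP.row t.toNNReal x))
      (Set.Ici t) t := by
  rw [← hasDerivWithinAt_Ioi_iff_Ici, hasDerivWithinAt_iff_tendsto_slope' (by simp)]
  have hlim : Tendsto (fun u : ℝ => (u - t).toNNReal) (𝓝[>] t) (𝓝[>] 0) := by
    refine tendsto_nhdsWithin_iff.2 ⟨?_, ?_⟩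
    · have : Tendsto (fun u : ℝ => (u - t).toNNReal) (𝓝 t) (𝓝 (t - t).toNNReal) :=
        (continuous_real_toNNReal.comp (continuous_id.sub continuous_const)).tendsto t
      simp only [sub_self, Real.toNNReal_zero] at this
      exact this.mono_left nhdsWithin_le_nhds
    · filter_upwards [self_mem_nhdsWithin] with u hu
      simpa using hu
  refine ((hP.tendsto_slope hA hc t.toNNReal x).comp hlim).congr' ?_
  filter_upwards [self_mem_nhdsWithin] with u hu
  have hu' : t < u := hu
  rw [Function.comp_apply, slope_def_module, Real.coe_toNNReal _ (by linarith),
    ← Real.toNNReal_add ht (by linarith), add_sub_cancel]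

/-- A transition function with bounded conservative `Q`-matrix `A` is `exp (t A)`. -/
theorem row_eq_exp (hA : IsConservative A) (hP : IsTransitionFunction A P)
    (hc : ∀ x, -A x x ≤ c) (t : ℝ≥0) (x : S) :
    hP.row t x = NormedSpace.exp ((t : ℝ) • hA.op hc) (L1.dirac x) := by
  have hd : ∀ s : ℝ, HasDerivAt (fun u : ℝ => NormedSpace.exp (u • hA.op hc) (L1.dirac x))
      (hA.op hc (NormedSpace.exp (s • hA.op hc) (L1.dirac x))) s := fun s => by
    have := (hasDerivAt_exp_smul_const' (𝕂 := ℝ) (hA.op hc) s).clm_apply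
      (hasDerivAt_const s (L1.dirac x))
    simpa using this
  have := ODE_solution_unique (v := fun _ => hA.op hc) (K := ‖hA.op hc‖₊) (a := 0) (b := t)
    (f := fun t : ℝ => hP.row t.toNNReal x)
    (g := fun u : ℝ => NormedSpace.exp (u • hA.op hc) (L1.dirac x))
    (fun _ => (hA.op hc).lipschitz) (hP.continuous_row hc x).continuousOn
    (fun s hs => hP.hasDerivWithinAt_row hA hc x s hs.1)
    (fun s _ => (hd s).continuousAt.continuousWithinAt) (fun s _ => (hd s).hasDerivWithinAt)
    (by simp [hP.row_zero])
  simpa using this ⟨t.2, le_rfl⟩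

end IsTransitionFunction

end SymplecticGT

namespace SymplecticGT

open Filter Topology

/-! ### Markov functions of a Markov process -/

variable {S T : Type*} {A : S → S → ℝ} {B : T → T → ℝ} {φ : S → T} {K : T → S → ℝ}
  {P : ℝ≥0 → S → S → ℝ} {c d : ℝ}

/-- `K` is a probability kernel from `T` to `S` that is supported on the fibres of `φ` and
intertwines the `Q`-matrices `B` and `A`. -/
structure IsIntertwining (A : S → S → ℝ) (B : T → T → ℝ) (φ : S → T) (K : T → S → ℝ) : Prop where
  nonneg : ∀ z x, 0 ≤ K z x
  hasSum_one : ∀ z, HasSum (K z) 1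
  eq_zero : ∀ z x, φ x ≠ z → K z x = 0
  comm : ∀ z x, HasSum (fun y => K z y * A y x) (B z (φ x) * K (φ x) x)

/-- The total mass of a summable function. -/
noncomputable def L1.total (S : Type*) : L1 S →L[ℝ] ℝ :=
  L1.ofKernel (fun _ => 1) 1 (by simp)

theorem L1.hasSum_total (f : L1 S) : HasSum f (L1.total S f) := by
  have h := L1.hasSum_ofKernel (fun _ : S => (1 : ℝ)) 1 (by simp) f
  simp only [smul_eq_mul, mul_one] at h
  exact h

namespace IsIntertwining

/-- A row of the kernel as a summable function. -/
def row (hK : IsIntertwining A B φ K) (z : T) : L1 S :=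
  L1.ofSummable (K z) (hK.hasSum_one z).summable

@[simp] theorem row_apply (hK : IsIntertwining A B φ K) (z : T) (x : S) : hK.row z x = K z x := rfl

theorem norm_row (hK : IsIntertwining A B φ K) (z : T) : ‖hK.row z‖ = 1 := by
  rw [L1.norm_eq_tsum, ← (hK.hasSum_one z).tsum_eq]
  exact tsum_congr fun y => abs_of_nonneg (hK.nonneg z y)

theorem op_row_apply (hK : IsIntertwining A B φ K) (hA : IsConservative A)
    (hc : ∀ x, -A x x ≤ c) (z : T) (x : S) :
    hA.op hc (hK.row z) x = B z (φ x) * K (φ x) x :=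
  (L1.hasSum_apply (L1.hasSum_ofKernel hA.row (2 * c) (hA.norm_row_le hc) (hK.row z)) x).unique
    (hK.comm z x)

theorem hasSum_fiber (hK : IsIntertwining A B φ K) (z : T) :
    HasSum (fun x : {x // φ x = z} => K z x) 1 := by
  refine (hasSum_subtype_iff_of_support_subset (f := K z) (s := {x | φ x = z}) ?_).2
    (hK.hasSum_one z)
  intro x hx
  by_contra h
  exact hx (hK.eq_zero z x h)

/-- The row vector `K A` has total mass `0` because `A` is conservative. Grouping its entries by the
fibres of `φ`, each of which has `K`-mass one, turns that total into a row sum of `B`. -/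
theorem hasSum_zero (hK : IsIntertwining A B φ K) (hA : IsConservative A)
    (hc : ∀ x, -A x x ≤ c) (z : T) : HasSum (B z) 0 := by
  have h1 := (L1.hasSum_ofKernel hA.row (2 * c) (hA.norm_row_le hc) (hK.row z)).mapL (L1.total S)
  have h2 : ∀ x, L1.total S (hA.row x) = 0 := fun x =>
    (L1.hasSum_total (hA.row x)).unique (hA.hasSum_zero x)
  simp only [map_smul, h2, smul_zero] at h1
  have h3 := L1.hasSum_total (hA.op hc (hK.row z))
  have h4 : L1.total S (hA.op hc (hK.row z)) = 0 := h1.unique _root_.hasSum_zero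
  rw [h4, ← (Equiv.sigmaFiberEquiv φ).hasSum_iff] at h3
  refine h3.sigma fun w => ?_
  have h5 := (hK.hasSum_fiber w).mul_left (B z w)
  rw [mul_one] at h5
  refine h5.congr_fun ?_
  rintro ⟨x, rfl⟩
  exact hK.op_row_apply hA hc z x

/-- The operator `f ↦ f K`. -/
noncomputable def lift (hK : IsIntertwining A B φ K) : L1 T →L[ℝ] L1 S :=
  L1.ofKernel hK.row 1 fun z => (hK.norm_row z).le

theorem lift_apply (hK : IsIntertwining A B φ K) (f : L1 T) (x : S) :
    hK.lift f x = f (φ x) * K (φ x) x := by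
  have h := L1.hasSum_apply (L1.hasSum_ofKernel hK.row 1 (fun z => (hK.norm_row z).le) f) x
  refine h.unique (hasSum_single (φ x) fun z hz => ?_)
  change f z * K z x = 0
  rw [hK.eq_zero z x hz.symm, mul_zero]

theorem op_lift (hK : IsIntertwining A B φ K) (hA : IsConservative A) (hc : ∀ x, -A x x ≤ c)
    (hB : IsConservative B) (hd : ∀ z, -B z z ≤ d) (f : L1 T) :
    hA.op hc (hK.lift f) = hK.lift (hB.op hd f) := by
  have : (hA.op hc).comp hK.lift = hK.lift.comp (hB.op hd) := by
    refine L1.clm_ext fun z => ?_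
    ext x
    have h : hK.lift (L1.dirac z) = hK.row z := L1.ofKernel_dirac _ _ _ _
    rw [ContinuousLinearMap.comp_apply, ContinuousLinearMap.comp_apply, h, hB.op_dirac,
      hK.lift_apply, hK.op_row_apply]
    rfl
  exact congrArg (fun L => L f) this

/-- The transition function `exp (t B)`. -/
noncomputable def expRow (hB : IsConservative B) (hd : ∀ z, -B z z ≤ d) (t : ℝ≥0) (z w : T) : ℝ :=
  NormedSpace.exp ((t : ℝ) • hB.op hd) (L1.dirac z) w

theorem hasDerivAt_exp {E : Type*} [NormedAddCommGroup E] [NormedSpace ℝ E] [CompleteSpace E]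
    (L : E →L[ℝ] E) (v : E) (s : ℝ) :
    HasDerivAt (fun u : ℝ => NormedSpace.exp (u • L) v) (L (NormedSpace.exp (s • L) v)) s := by
  simpa using (hasDerivAt_exp_smul_const' (𝕂 := ℝ) L s).clm_apply (hasDerivAt_const s v)

/-- Both sides solve the linear equation `u' = A u` with the same initial value. -/
theorem exp_lift (hK : IsIntertwining A B φ K) (hA : IsConservative A) (hc : ∀ x, -A x x ≤ c)
    (hB : IsConservative B) (hd : ∀ z, -B z z ≤ d) (f : L1 T) (t : ℝ) :
    NormedSpace.exp (t • hA.op hc) (hK.lift f) = hK.lift (NormedSpace.exp (t • hB.op hd) f) := by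
  have := ODE_solution_unique_univ (v := fun _ => hA.op hc) (K := ‖hA.op hc‖₊) (t₀ := 0)
    (s := fun _ => Set.univ)
    (f := fun t : ℝ => NormedSpace.exp (t • hA.op hc) (hK.lift f))
    (g := fun t : ℝ => hK.lift (NormedSpace.exp (t • hB.op hd) f))
    (fun _ => (hA.op hc).lipschitz.lipschitzOnWith)
    (fun s => ⟨hasDerivAt_exp _ _ s, trivial⟩)
    (fun s => ⟨by
      rw [hK.op_lift hA hc hB hd]
      exact hK.lift.hasFDerivAt.comp_hasDerivAt s (hasDerivAt_exp (hB.op hd) f s), trivial⟩)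
    (by simp)
  exact congrFun this t

theorem hasSum_mul (hK : IsIntertwining A B φ K) (hA : IsConservative A) (hc : ∀ x, -A x x ≤ c)
    (hB : IsConservative B) (hd : ∀ z, -B z z ≤ d) (hP : IsTransitionFunction A P)
    (t : ℝ≥0) (z : T) (y : S) :
    HasSum (fun x => K z x * P t x y) (expRow hB hd t z (φ y) * K (φ y) y) := by
  have h := L1.hasSum_apply
    (L1.hasSum_clm (NormedSpace.exp ((t : ℝ) • hA.op hc)) (hK.row z)) y
  have h1 : hK.lift (L1.dirac z) = hK.row z := L1.ofKernel_dirac _ _ _ _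
  rw [← h1, hK.exp_lift hA hc hB hd, hK.lift_apply, h1] at h
  simp_rw [← hP.row_eq_exp hA hc] at h
  exact h

theorem total_exp (hK : IsIntertwining A B φ K) (hA : IsConservative A) (hc : ∀ x, -A x x ≤ c)
    (hB : IsConservative B) (hd : ∀ z, -B z z ≤ d) (hP : IsTransitionFunction A P)
    (t : ℝ≥0) (z : T) : HasSum (expRow hB hd t z) 1 := by
  have h := (L1.hasSum_clm (NormedSpace.exp ((t : ℝ) • hA.op hc)) (hK.row z)).mapL (L1.total S)
  have h1 : hK.lift (L1.dirac z) = hK.row z := L1.ofKernel_dirac _ _ _ _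
  have h2 : ∀ x, L1.total S (hP.row t x) = 1 := fun x =>
    (L1.hasSum_total _).unique (hP.hasSum_one t x)
  simp_rw [map_smul, ← hP.row_eq_exp hA hc, h2] at h
  rw [← h1, hK.exp_lift hA hc hB hd, h1] at h
  have h3 : L1.total S (hK.lift (NormedSpace.exp ((t : ℝ) • hB.op hd) (L1.dirac z))) = 1 :=
    h.unique (by simpa using hK.hasSum_one z)
  have h4 := L1.hasSum_total (hK.lift (NormedSpace.exp ((t : ℝ) • hB.op hd) (L1.dirac z)))
  rw [h3, ← (Equiv.sigmaFiberEquiv φ).hasSum_iff] at h4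
  refine h4.sigma fun w => ?_
  have h5 := (hK.hasSum_fiber w).mul_left (expRow hB hd t z w)
  rw [mul_one] at h5
  refine h5.congr_fun ?_
  rintro ⟨x, rfl⟩
  exact hK.lift_apply _ x

/-- By `hasSum_mul`, multiplying the entry by some `K w x > 0` gives a sum of nonnegative terms.
Such an `x` exists because `K w` has total mass one. -/
theorem expRow_nonneg (hK : IsIntertwining A B φ K) (hA : IsConservative A)
    (hc : ∀ x, -A x x ≤ c) (hB : IsConservative B) (hd : ∀ z, -B z z ≤ d)
    (hP : IsTransitionFunction A P) (t : ℝ≥0) (z w : T) : 0 ≤ expRow hB hd t z w := by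
  obtain ⟨x, hx⟩ : ∃ x, K w x ≠ 0 := by
    by_contra! h
    have h1 := hK.hasSum_one w
    rw [show K w = fun _ => 0 from funext h] at h1
    exact one_ne_zero (h1.unique _root_.hasSum_zero)
  obtain rfl : φ x = w := by
    by_contra h
    exact hx (hK.eq_zero w x h)
  have h := (hK.hasSum_mul hA hc hB hd hP t z x).nonneg fun y =>
    mul_nonneg (hK.nonneg z y) (hP.nonneg t y x)
  exact nonneg_of_mul_nonneg_left h ((hK.nonneg _ _).lt_of_ne' hx)

theorem isTransitionFunction (hK : IsIntertwining A B φ K) (hA : IsConservative A)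
    (hc : ∀ x, -A x x ≤ c) (hB : IsConservative B) (hd : ∀ z, -B z z ≤ d)
    (hP : IsTransitionFunction A P) : IsTransitionFunction B (expRow hB hd) where
  nonneg := hK.expRow_nonneg hA hc hB hd hP
  hasSum_one := hK.total_exp hA hc hB hd hP
  zero z w := by simp [expRow, L1.dirac_apply]
  chapman_kolmogorov s t z w := by
    have h := L1.hasSum_apply (L1.hasSum_clm (NormedSpace.exp ((t : ℝ) • hB.op hd))
      (NormedSpace.exp ((s : ℝ) • hB.op hd) (L1.dirac z))) w
    have e : NormedSpace.exp (((s + t : ℝ≥0) : ℝ) • hB.op hd)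
        = NormedSpace.exp ((t : ℝ) • hB.op hd) * NormedSpace.exp ((s : ℝ) • hB.op hd) := by
      let _ : NormedAlgebra ℚ (L1 T →L[ℝ] L1 T) := NormedAlgebra.restrictScalars ℚ ℝ _
      rw [NNReal.coe_add, add_comm, add_smul]
      exact NormedSpace.exp_add_of_commute (((Commute.refl _).smul_left _).smul_right _)
    rw [expRow, e]
    exact h
  deriv_zero z w := by
    have h := (hasDerivAt_exp (hB.op hd) (L1.dirac z) 0).hasDerivWithinAt (s := Set.Ioi 0)
    rw [hasDerivWithinAt_iff_tendsto_slope' (by simp)] at h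
    have hlim : Tendsto (fun t : ℝ≥0 => (t : ℝ)) (𝓝[>] 0) (𝓝[>] 0) := by
      refine tendsto_nhdsWithin_iff.2 ⟨?_, ?_⟩
      · exact (NNReal.continuous_coe.tendsto' 0 0 rfl).mono_left nhdsWithin_le_nhds
      · filter_upwards [self_mem_nhdsWithin] with t ht
        exact ht
    have h1 := L1.tendsto_apply (h.comp hlim) w
    simp only [zero_smul, NormedSpace.exp_zero, one_apply_eq_self, hB.op_dirac,
      hB.row_apply] at h1
    refine h1.congr fun t => ?_
    rw [Function.comp_apply, slope_def_module, sub_zero, zero_smul, NormedSpace.exp_zero,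
      div_eq_inv_mul]
    simp only [expRow, NNReal.coe_zero, zero_smul, NormedSpace.exp_zero]
    rfl

end IsIntertwining

/-! ### Finite-dimensional distributions of the image process -/

open scoped ENNReal

/-- The sum over all paths above a given path. -/
theorem tsum_paths {κ : T → S → ℝ≥0∞} {p : ℝ≥0 → S → S → ℝ≥0∞} {r : ℝ≥0 → T → T → ℝ≥0∞}
    (h0 : ∀ z x, φ x ≠ z → κ z x = 0) (h1 : ∀ z, ∑' x, κ z x = 1)
    (h2 : ∀ t z y, ∑' x, κ z x * p t x y = r t z (φ y) * κ (φ y) y) (N : ℕ) :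
    ∀ (τ : Fin N → ℝ≥0) (s : Fin (N + 1) → T),
      ∑' x : {x : Fin (N + 1) → S // ∀ i, φ (x i) = s i},
        κ (s 0) (x.1 0) * ∏ i : Fin N, p (τ i) (x.1 i.castSucc) (x.1 i.succ) =
      ∏ i : Fin N, r (τ i) (s i.castSucc) (s i.succ) := by
  classical
  have hind : ∀ (M : ℕ) (s : Fin (M + 1) → T) (f : (Fin (M + 1) → S) → ℝ≥0∞),
      ∑' x : {x : Fin (M + 1) → S // ∀ i, φ (x i) = s i}, f x.1
        = ∑' x, if ∀ i, φ (x i) = s i then f x else 0 := by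
    intro M s f
    exact (tsum_subtype {x : Fin (M + 1) → S | ∀ i, φ (x i) = s i} f).trans
      (tsum_congr fun x => by simp [Set.indicator_apply])
  induction N with
  | zero =>
    intro τ s
    rw [hind 0 s fun x => κ (s 0) (x 0) * ∏ i : Fin 0, p (τ i) (x i.castSucc) (x i.succ)]
    rw [← (Equiv.funUnique (Fin 1) S).symm.tsum_eq]
    simp only [Finset.univ_eq_empty, Finset.prod_empty, mul_one]
    rw [← h1 (s 0)]
    refine tsum_congr fun x => ?_
    split_ifs with h
    · rfl
    · refine (h0 _ _ fun h' => h fun i => ?_).symm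
      rw [Subsingleton.elim (α := Fin 1) i 0]
      exact h'
  | succ N ih =>
    intro τ s
    rw [hind (N + 1) s fun x => κ (s 0) (x 0) *
      ∏ i : Fin (N + 1), p (τ i) (x i.castSucc) (x i.succ)]
    rw [← (Fin.consEquiv fun _ => S).tsum_eq, ENNReal.tsum_prod', ENNReal.tsum_comm]
    have ih' := ih (fun i => τ i.succ) (fun i => s i.succ)
    rw [hind N (fun i => s i.succ) fun x => κ (s (Fin.succ 0)) (x 0) *
      ∏ i : Fin N, p (τ i.succ) (x i.castSucc) (x i.succ)] at ih'
    rw [Fin.prod_univ_succ]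
    simp only [Fin.castSucc_zero, ← Fin.succ_castSucc]
    rw [← ih', ← ENNReal.tsum_mul_left]
    refine tsum_congr fun x => ?_
    simp only [Fin.consEquiv_apply, Fin.prod_univ_succ, Fin.cons_zero, Fin.cons_succ,
      Fin.castSucc_zero, ← Fin.succ_castSucc, Fin.forall_fin_succ (n := N + 1)]
    by_cases h : ∀ i : Fin (N + 1), φ (x i) = s i.succ
    · simp only [h, implies_true, and_true, if_true]
      -- Summing out the initial state leaves one factor `r` and the kernel `κ` at the next state,
      -- which is the shape required by the induction hypothesis.
      have h3 := h2 (τ 0) (s 0) (x 0)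
      rw [h 0] at h3
      rw [← mul_assoc, ← h3, ← ENNReal.tsum_mul_right]
      refine tsum_congr fun a => ?_
      by_cases ha : φ a = s 0
      · rw [if_pos ha, mul_assoc]
      · rw [if_neg ha, h0 _ _ ha, zero_mul, zero_mul]
    · simp [h]

/-- A function of a Markov process whose `Q`-matrix is intertwined with another one is Markov. -/
theorem IsMarkovProcess.of_isIntertwining [Countable S] [DecidableEq T] {Ω : Type*} [MeasurableSpace Ω]
    {μ : MeasureTheory.Measure Ω} {X : ℝ≥0 → Ω → S} {z : T}
    (hK : IsIntertwining A B φ K) (hA : IsConservative A)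
    (hc : ∀ x, -A x x ≤ c) (hB : IsConservative B) (hd : ∀ z, -B z z ≤ d)
    (hX : IsMarkovProcess μ X A (K z)) :
    IsMarkovProcess μ (fun t ω => φ (X t ω)) B fun w => if w = z then 1 else 0 := by
  obtain ⟨hm, P, hP, hfdd⟩ := hX
  have hR := hK.isTransitionFunction hA hc hB hd hP
  refine ⟨fun t s => ?_, IsIntertwining.expRow hB hd, hR, fun N t s ht ht0 => ?_⟩
  · have : {ω | φ (X t ω) = s} = ⋃ x : {x // φ x = s}, {ω | X t ω = x} := by
      ext ω; simp
    rw [this]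
    exact MeasurableSet.iUnion fun x => hm t x
  · have hset : {ω | ∀ i, φ (X (t i) ω) = s i} =
        ⋃ x : {x : Fin (N + 1) → S // ∀ i, φ (x i) = s i}, {ω | ∀ i, X (t i) ω = x.1 i} := by
      ext ω
      simp only [Set.mem_ofPred_eq, Set.mem_iUnion]
      exact ⟨fun h => ⟨⟨fun i => X (t i) ω, h⟩, fun i => rfl⟩, fun ⟨x, hx⟩ i => by rw [hx, x.2]⟩
    rw [hset, MeasureTheory.measure_iUnion]
    · have e : ∀ x : {x : Fin (N + 1) → S // ∀ i, φ (x i) = s i},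
          μ {ω | ∀ i, X (t i) ω = x.1 i} = ENNReal.ofReal (K z (x.1 0)) *
            ∏ i : Fin N, ENNReal.ofReal (P (t i.succ - t i.castSucc) (x.1 i.castSucc) (x.1 i.succ)) := by
        intro x
        rw [hfdd N t x.1 ht ht0, ENNReal.ofReal_mul (hK.nonneg _ _),
          ENNReal.ofReal_prod_of_nonneg fun i _ => hP.nonneg _ _ _]
      simp_rw [e]
      by_cases hz : s 0 = z
      · rw [if_pos hz, one_mul, ENNReal.ofReal_prod_of_nonneg fun i _ => hR.nonneg _ _ _, ← hz]
        refine tsum_paths (κ := fun z x => ENNReal.ofReal (K z x))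
          (p := fun t x y => ENNReal.ofReal (P t x y))
          (r := fun t z w => ENNReal.ofReal (IsIntertwining.expRow hB hd t z w))
          (fun z x h => ?_) (fun z => ?_) (fun t z y => ?_) N _ s
        · simp only [hK.eq_zero z x h, ENNReal.ofReal_zero]
        · rw [← ENNReal.ofReal_tsum_of_nonneg (hK.nonneg z) (hK.hasSum_one z).summable,
            (hK.hasSum_one z).tsum_eq, ENNReal.ofReal_one]
        · have h := hK.hasSum_mul hA hc hB hd hP t z y
          simp_rw [← ENNReal.ofReal_mul (hK.nonneg z _)]
          rw [← ENNReal.ofReal_mul (hR.nonneg _ _ _), ← h.tsum_eq,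
            ENNReal.ofReal_tsum_of_nonneg (fun x => mul_nonneg (hK.nonneg _ _) (hP.nonneg _ _ _))
              h.summable]
      · rw [if_neg hz, zero_mul, ENNReal.ofReal_zero, ENNReal.tsum_eq_zero]
        intro x
        rw [hK.eq_zero z (x.1 0) (by rw [x.2 0]; exact hz), ENNReal.ofReal_zero, zero_mul]
    · intro x y hxy
      refine Set.disjoint_left.2 fun ω h1 h2 => hxy (Subtype.ext (funext fun i => ?_))
      rw [← h1 i, ← h2 i]
    · intro x
      simp only [Set.ofPred_forall]
      exact MeasurableSet.iInter fun i => hm _ _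

end SymplecticGT

namespace SymplecticGT

open Relation

/-! ### Pushing along chains -/

variable {S : Type*}

/-- A partial injection that raises the level `row` by one. -/
structure IsStep (R : S → S → Prop) (row : S → ℤ) : Prop where
  row_eq : ∀ a b, R a b → row b = row a + 1
  left_unique : ∀ a b c, R a c → R b c → a = b
  right_unique : ∀ a b c, R a b → R a c → b = c

/-- A step from one particle to another at the same site. -/
abbrev Pushes (R : S → S → Prop) (x : S → ℤ) (c d : S) : Prop := R c d ∧ x c = x d

open scoped Classical in
/-- Moving `a` one step up, together with all particles that are pushed. -/
noncomputable def push (R : S → S → Prop) (x : S → ℤ) (a : S) : S → ℤ :=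
  fun b => if ReflTransGen (Pushes R x) a b then x b + 1 else x b

/-- Moving `b` one step down, together with all particles that may have pushed it. -/
noncomputable def unpush (R : S → S → Prop) (x : S → ℤ) (b : S) : S → ℤ :=
  -push (flip R) (-x) b

/-- The product of powers of `G (row e) / G (row e + 1)` with the exponents `x e`. -/
noncomputable def levelWeight [Fintype S] (row : S → ℤ) (G : ℤ → ℝ) (x : S → ℤ) : ℝ :=
  ∏ e, (G (row e) / G (row e + 1)) ^ x e

namespace IsStep

variable {R : S → S → Prop} {row : S → ℤ}

theorem flip (hR : IsStep R row) : IsStep (flip R) (-row) where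
  row_eq a b h := by
    have := hR.row_eq b a h
    simp only [Pi.neg_apply]; linarith
  left_unique a b c h1 h2 := hR.right_unique c a b h1 h2
  right_unique a b c h1 h2 := hR.left_unique b c a h1 h2

theorem row_le (hR : IsStep R row) {x : S → ℤ} {a b : S}
    (h : ReflTransGen (Pushes R x) a b) : row a ≤ row b := by
  induction h with
  | refl => exact le_rfl
  | tail _ h ih => have := hR.row_eq _ _ h.1; linarith

theorem eq_of_row_le (hR : IsStep R row) {x : S → ℤ} {a b : S}
    (h : ReflTransGen (Pushes R x) a b) (hr : row b ≤ row a) : a = b := by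
  rcases ReflTransGen.cases_head h with h | ⟨c, h1, h2⟩
  · exact h
  · have := hR.row_eq _ _ h1.1
    have := hR.row_le h2
    linarith

theorem push_self (x : S → ℤ) (a : S) : push R x a a = x a + 1 := if_pos .refl

theorem le_push (x : S → ℤ) (a b : S) : x b ≤ push R x a b := by
  unfold push
  split_ifs <;> linarith

theorem reflTransGen_iff (x : S → ℤ) (a b : S) :
    ReflTransGen (Pushes R x) a b ↔ push R x a b = x b + 1 := by
  unfold push
  split_ifs with h <;> simp [h]

theorem push_of_row_lt (hR : IsStep R row) {x : S → ℤ} {a b : S} (h : row b < row a) :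
    push R x a b = x b :=
  if_neg fun h' => absurd (hR.row_le h') (not_le.2 h)

/-- If two particles produce the same configuration, each lies on the chain pushed by the other,
while rows strictly increase along a chain. -/
theorem push_injective (hR : IsStep R row) (x : S → ℤ) : Function.Injective (push R x) := by
  intro a b h
  have h1 : ReflTransGen (Pushes R x) a b := by
    rw [reflTransGen_iff, h, push_self]
  have h2 : ReflTransGen (Pushes R x) b a := by
    rw [reflTransGen_iff, ← h, push_self]
  exact hR.eq_of_row_le h1 (hR.row_le h2)

-- The pushed particles form a single chain occupying consecutive rows, so the product telescopes.
open scoped Classical in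
theorem exists_last [Fintype S] (hR : IsStep R row) (x : S → ℤ) (a : S) :
    ∃ b, ReflTransGen (Pushes R x) a b ∧ (∀ d, ¬ Pushes R x b d) ∧
      ∀ G : ℤ → ℝ, (∀ r, G r ≠ 0) →
        ∏ e with ReflTransGen (Pushes R x) a e, G (row e) / G (row e + 1) =
          G (row a) / G (row b + 1) := by
  obtain ⟨M, hM⟩ : ∃ M, ∀ a, row a ≤ M := by
    obtain ⟨M, hM⟩ := (Set.finite_range row).bddAbove
    exact ⟨M, fun a => hM ⟨a, rfl⟩⟩
  induction hk : (M - row a).toNat using Nat.strong_induction_on generalizing a with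
  | _ k ih =>
    by_cases h : ∃ d, Pushes R x a d
    · obtain ⟨d, hd⟩ := h
      have hrow := hR.row_eq _ _ hd.1
      have := hM d
      obtain ⟨b, h1, h2, h3⟩ := ih _ (by omega) d rfl
      refine ⟨b, h1.head hd, h2, fun G hG => ?_⟩
      have hset : (Finset.univ.filter fun e => ReflTransGen (Pushes R x) a e)
          = insert a (Finset.univ.filter fun e => ReflTransGen (Pushes R x) d e) := by
        ext e
        simp only [Finset.mem_filter, Finset.mem_univ, true_and, Finset.mem_insert]
        constructor
        · intro he
          rcases ReflTransGen.cases_head he with rfl | ⟨c, h4, h5⟩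
          · exact Or.inl rfl
          · rw [hR.right_unique _ _ _ hd.1 h4.1]
            exact Or.inr h5
        · rintro (rfl | he)
          · exact .refl
          · exact he.head hd
      rw [hset, Finset.prod_insert, h3 G hG, ← hrow, div_mul_div_cancel₀ (hG _)]
      simp only [Finset.mem_filter, Finset.mem_univ, true_and]
      intro h4
      have := hR.row_le h4
      omega
    · push Not at h
      refine ⟨a, .refl, h, fun G _ => ?_⟩
      have hset : (Finset.univ.filter fun e => ReflTransGen (Pushes R x) a e) = {a} := by
        ext e
        simp only [Finset.mem_filter, Finset.mem_univ, true_and, Finset.mem_singleton]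
        constructor
        · intro he
          rcases ReflTransGen.cases_head he with rfl | ⟨c, h4, h5⟩
          · rfl
          · exact absurd h4 (h c)
        · rintro rfl
          exact .refl
      rw [hset, Finset.prod_singleton]

/-- After the push, the particles reached by going up from `b` along equal positions are exactly the
moved chain. The climb cannot pass above `a`: an unmoved `d` with `R d c` and `c` moved has `x d ≤ x
c < x c + 1`. -/
theorem unpush_push_last (hR : IsStep R row) {x : S → ℤ} (hx : ∀ c d, R c d → x c ≤ x d)
    {a b : S} (hab : ReflTransGen (Pushes R x) a b) (hb : ∀ d, ¬ Pushes R x b d) :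
    unpush R (push R x a) b = x := by
  have h1 : ∀ e, ReflTransGen (Pushes R x) e b → ReflTransGen (Pushes R x) a e →
      ReflTransGen (Pushes (_root_.flip R) (-push R x a)) b e := by
    intro e he
    induction he using ReflTransGen.head_induction_on with
    | refl => exact fun _ => .refl
    | head h h' ih =>
      intro hae
      have hac := hae.tail h
      refine (ih hac).tail ⟨h.1, ?_⟩
      rw [reflTransGen_iff] at hae hac
      simp only [Pi.neg_apply, hae, hac, h.2]
  have h2 : ∀ e, ReflTransGen (Pushes (_root_.flip R) (-push R x a)) b e →
      ReflTransGen (Pushes R x) a e := by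
    intro e he
    induction he with
    | refl => exact hab
    | @tail c d _ h ih =>
      by_contra hd
      have h3 : push R x a d = x d := if_neg hd
      have h4 := (reflTransGen_iff x a c).1 ih
      have h5 := h.2
      simp only [Pi.neg_apply, h3, h4] at h5
      have := hx d c h.1
      linarith
  funext e
  have hiff : ReflTransGen (Pushes (_root_.flip R) (-push R x a)) b e ↔
      ReflTransGen (Pushes R x) a e := by
    refine ⟨h2 e, fun he => h1 e ?_ he⟩
    have hu : Relator.RightUnique (Pushes R x) := fun p q r h h' => hR.right_unique p q r h.1 h'.1
    rcases ReflTransGen.total_of_right_unique hu hab he with h | h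
    · rcases ReflTransGen.cases_head h with rfl | ⟨c, h4, _⟩
      · exact .refl
      · exact absurd h4 (hb c)
    · exact h
  have h3 : unpush R (push R x a) b e = -push (_root_.flip R) (-push R x a) b e := rfl
  rw [h3]
  by_cases he : ReflTransGen (Pushes R x) a e
  · rw [(reflTransGen_iff _ _ _).1 (hiff.2 he), Pi.neg_apply, (reflTransGen_iff _ _ _).1 he]
    ring
  · have h4 : push R x a e = x e := if_neg he
    have h5 : push (_root_.flip R) (-push R x a) b e = (-push R x a) e :=
      if_neg fun h => he (hiff.1 h)
    rw [h5, Pi.neg_apply, h4, neg_neg]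

theorem exists_unpush [Fintype S] (hR : IsStep R row) {x : S → ℤ}
    (hx : ∀ c d, R c d → x c ≤ x d) (a : S) :
    ∃ b, unpush R (push R x a) b = x ∧ ∀ G : ℤ → ℝ, (∀ r, G r ≠ 0) →
      levelWeight row G (push R x a) = levelWeight row G x * (G (row a) / G (row b + 1)) := by
  classical
  obtain ⟨b, h1, h2, h3⟩ := hR.exists_last x a
  refine ⟨b, hR.unpush_push_last hx h1 h2, fun G hG => ?_⟩
  rw [← h3 G hG, levelWeight, levelWeight, Finset.prod_filter, ← Finset.prod_mul_distrib]
  refine Finset.prod_congr rfl fun e _ => ?_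
  unfold push
  split_ifs with h
  · rw [zpow_add_one₀ (div_ne_zero (hG _) (hG _))]
  · rw [mul_one]

/-- This is `exists_unpush` for the reversed relation and the negated configuration, which exchanges
`push` and `unpush`. -/
theorem exists_push [Fintype S] (hR : IsStep R row) {x : S → ℤ}
    (hx : ∀ c d, R c d → x c ≤ x d) (b : S) : ∃ a, push R (unpush R x b) a = x := by
  obtain ⟨a, h, _⟩ := hR.flip.exists_unpush (x := -x) (fun c d h => neg_le_neg (hx d c h)) b
  refine ⟨a, ?_⟩
  rw [← neg_inj, ← h]
  rfl

theorem unpush_injective (hR : IsStep R row) (x : S → ℤ) : Function.Injective (unpush R x) :=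
  fun _ _ h => hR.flip.push_injective (-x) (neg_injective h)

open scoped Classical in
/-- The reversal of the pushing dynamics: summing over all ways to reach `x` from `F` amounts to
summing over the last particle that moves. -/
theorem sum_push [Fintype S] (hR : IsStep R row) (F : Finset (S → ℤ))
    (hF : ∀ y ∈ F, ∀ c d, R c d → y c ≤ y d) {x : S → ℤ} (hx : ∀ c d, R c d → x c ≤ x d)
    {G : ℤ → ℝ} (hG : ∀ r, G r ≠ 0) :
    ∑ y ∈ F, ∑ a, (if x = push R y a then levelWeight row G y * G (row a) else 0) =
      levelWeight row G x * ∑ b, if unpush R x b ∈ F then G (row b + 1) else 0 := by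
  -- To a pair (previous configuration, particle that starts the jump) associate the last moved
  -- particle `b`; `x` and `b` determine the pair, so this is a bijection onto the admissible `b`.
  have hex : ∀ p : (S → ℤ) × S, ∃ b, p.1 ∈ F → x = push R p.1 p.2 → unpush R x b = p.1 ∧
      levelWeight row G p.1 * G (row p.2) = levelWeight row G x * G (row b + 1) := by
    intro p
    by_cases h : p.1 ∈ F ∧ x = push R p.1 p.2
    · obtain ⟨b, h1, h2⟩ := hR.exists_unpush (hF p.1 h.1) p.2
      refine ⟨b, fun _ h' => ⟨by rw [h', h1], ?_⟩⟩
      rw [h', h2 G hG, mul_assoc, div_mul_cancel₀ _ (hG _)]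
    · exact ⟨p.2, fun h1 h2 => absurd ⟨h1, h2⟩ h⟩
  choose f hf using hex
  rw [← Finset.sum_product', ← Finset.sum_filter, ← Finset.sum_filter, Finset.mul_sum]
  refine Finset.sum_bij (fun p _ => f p) ?_ ?_ ?_ ?_
  · intro p hp
    simp only [Finset.mem_filter, Finset.mem_product, Finset.mem_univ, and_true, true_and] at hp ⊢
    rw [(hf p hp.1 hp.2).1]
    exact hp.1
  · intro p hp p' hp' h
    simp only [Finset.mem_filter, Finset.mem_product, Finset.mem_univ, and_true] at hp hp'
    have h1 : p.1 = p'.1 := by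
      rw [← (hf p hp.1 hp.2).1, ← (hf p' hp'.1 hp'.2).1, h]
    refine Prod.ext h1 (hR.push_injective p.1 ?_)
    rw [← hp.2, h1, ← hp'.2]
  · intro b hb
    simp only [Finset.mem_filter, Finset.mem_univ, true_and] at hb
    obtain ⟨a, ha⟩ := hR.exists_push hx b
    refine ⟨(unpush R x b, a), ?_, ?_⟩
    · simpa using ⟨hb, ha.symm⟩
    · exact hR.unpush_injective x (hf (unpush R x b, a) hb ha.symm).1
  · intro p hp
    simp only [Finset.mem_filter, Finset.mem_product, Finset.mem_univ, and_true] at hp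
    exact (hf p hp.1 hp.2).2

end IsStep

end SymplecticGT

namespace SymplecticGT

open Relation

/-! ### The geometry of patterns -/

section Push

variable {S : Type*} {R L : S → S → Prop} {row : S → ℤ} {x : S → ℤ} {a : S}

theorem push_mono (hR : ∀ c d, R c d → x c ≤ x d) (a c d : S) (h : R c d) :
    push R x a c ≤ push R x a d := by
  by_cases hc : ReflTransGen (Pushes R x) a c
  · rcases (hR c d h).eq_or_lt with h1 | h1
    · rw [(IsStep.reflTransGen_iff x a c).1 hc,
        (IsStep.reflTransGen_iff x a d).1 (hc.tail ⟨h, h1⟩), h1]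
    · rw [(IsStep.reflTransGen_iff x a c).1 hc]
      have := IsStep.le_push (R := R) x a d
      omega
  · have h1 : push R x a c = x c := if_neg hc
    rw [h1]
    exact (hR c d h).trans (IsStep.le_push x a d)

/-- If a particle is not blocked, then neither are the particles that it pushes. -/
theorem ne_of_reflTransGen
    (hdia : ∀ e u d, ReflTransGen (Pushes R x) a e → Pushes R x e d → L u d → x u = x d →
      ∃ v, L v e ∧ R v u)
    (hR : ∀ c d, R c d → x c ≤ x d) (hL : ∀ c d, L c d → x d ≤ x c)
    (ha : ∀ c, L c a → x c ≠ x a) {d : S} (h : ReflTransGen (Pushes R x) a d) :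
    ∀ c, L c d → x c ≠ x d := by
  induction h with
  | refl => exact ha
  | @tail e d he h ih =>
    intro u hu heq
    obtain ⟨v, h1, h2⟩ := hdia e u d he h hu heq
    have h3 := hL v e h1
    have h4 := hR v u h2
    exact ih v h1 (by have := h.2; omega)

theorem push_left_le
    (hdia : ∀ e u d, ReflTransGen (Pushes R x) a e → Pushes R x e d → L u d → x u = x d →
      ∃ v, L v e ∧ R v u)
    (hR : ∀ c d, R c d → x c ≤ x d) (hL : ∀ c d, L c d → x d ≤ x c)
    (ha : ∀ c, L c a → x c ≠ x a) (c d : S) (h : L c d) : push R x a d ≤ push R x a c := by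
  have h1 := IsStep.le_push (R := R) x a c
  have h2 := hL c d h
  by_cases hd : ReflTransGen (Pushes R x) a d
  · rw [(IsStep.reflTransGen_iff x a d).1 hd]
    have := ne_of_reflTransGen hdia hR hL ha hd c h
    omega
  · have h3 : push R x a d = x d := if_neg hd
    omega

theorem eq_of_reflTransGen {d : S} (h : ReflTransGen (Pushes R x) a d) : x a = x d := by
  induction h with
  | refl => rfl
  | tail _ h ih => exact ih.trans h.2

end Push

variable {n : ℕ}

/-! ### Neighbour relations between particles -/

namespace Particle

theorem bounds (a : Particle n) : 1 ≤ a.row ∧ a.row ≤ n ∧ 1 ≤ a.idx ∧ a.idx ≤ (a.row + 1) / 2 :=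
  mem_positions.1 a.2

theorem ext_row_idx {a b : Particle n} (h1 : a.row = b.row) (h2 : a.idx = b.idx) : a = b :=
  Subtype.ext (Prod.ext h1 h2)

theorem exists_of_bounds {r i : ℕ} (h : 1 ≤ r ∧ r ≤ n ∧ 1 ≤ i ∧ i ≤ (r + 1) / 2) :
    ∃ a : Particle n, a.row = r ∧ a.idx = i :=
  ⟨⟨(r, i), mem_positions.2 h⟩, rfl, rfl⟩

/-- The row of a particle as an integer. -/
def level (a : Particle n) : ℤ := a.row

end Particle

theorem isStep_rightBelow : IsStep (RightBelow (n := n)) Particle.level where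
  row_eq a b h := by simp only [Particle.level, h.1]; push_cast; ring
  left_unique a b c h1 h2 := by
    obtain ⟨h1, h3⟩ := h1
    obtain ⟨h2, h4⟩ := h2
    have : a.row = b.row := by omega
    rw [this] at h3
    exact Particle.ext_row_idx this (by omega)
  right_unique a b c h1 h2 :=
    Particle.ext_row_idx (by rw [h1.1, h2.1]) (by rw [h1.2, h2.2])

theorem isStep_leftBelow : IsStep (LeftBelow (n := n)) Particle.level where
  row_eq a b h := by simp only [Particle.level, h.1]; push_cast; ring
  left_unique a b c h1 h2 := by
    obtain ⟨h1, h3⟩ := h1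
    obtain ⟨h2, h4⟩ := h2
    have : a.row = b.row := by omega
    rw [this] at h3
    exact Particle.ext_row_idx this (by omega)
  right_unique a b c h1 h2 := by
    have := h1.2
    have := h2.2
    exact Particle.ext_row_idx (by rw [h1.1, h2.1]) (by omega)

/-- Two adjacent particles of a row that share a neighbour below also share one above. By
interlacing, if `e`, `u` and `d` are at one site, that upper particle is there too and blocks `e`;
this is why a pushed particle is never obstructed. -/
theorem exists_above_right (e u d : Particle n) (h1 : RightBelow e d) (h2 : LeftBelow u d) :
    ∃ v, LeftBelow v e ∧ RightBelow v u := by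
  obtain ⟨h1, h3⟩ := h1
  obtain ⟨h2, h4⟩ := h2
  have hr : u.row = e.row := by omega
  have hi : u.idx = e.idx + 1 := by rw [hr] at h4; omega
  have he := e.bounds
  have hu := u.bounds
  rw [hr, hi] at hu
  have h5 : 3 ≤ e.row := by omega
  obtain ⟨v, hv1, hv2⟩ := Particle.exists_of_bounds (n := n) (r := e.row - 1)
    (i := e.idx + (e.row - 1) % 2) (by omega)
  refine ⟨v, ⟨by omega, by rw [hv1, hv2]⟩, by omega, ?_⟩
  rw [hv1, hv2]
  omega

theorem exists_above_left (e u d : Particle n) (h1 : LeftBelow e d) (h2 : RightBelow u d) :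
    ∃ v, RightBelow v e ∧ LeftBelow v u := by
  obtain ⟨v, h3, h4⟩ := exists_above_right u e d h2 h1
  exact ⟨v, h4, h3⟩

theorem jumpRight_eq (x : Particle n → ℤ) (a : Particle n) :
    jumpRight x a = push RightBelow x a := rfl

theorem pushes_neg {S : Type*} (R : S → S → Prop) (x : S → ℤ) : Pushes R (-x) = Pushes R x := by
  funext c d
  simp only [Pushes, Pi.neg_apply, neg_inj]

theorem jumpLeft_eq (x : Particle n → ℤ) (a : Particle n) :
    jumpLeft x a = -push LeftBelow (-x) a := by
  classical
  funext b
  have h : jumpLeft x a b = if ReflTransGen (Pushes LeftBelow x) a b then x b - 1 else x b := rfl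
  simp only [h, push, Pi.neg_apply, pushes_neg]
  split_ifs <;> ring

theorem isPattern_jumpRight {x : Particle n → ℤ} (hx : IsPattern x) {a : Particle n}
    (ha : ¬ RightBlocked x a) : IsPattern (jumpRight x a) where
  nonneg b := (hx.nonneg b).trans (IsStep.le_push x a b)
  le_right := push_mono hx.le_right a
  left_le := push_left_le (fun e u d _ h hu _ => exists_above_right e u d h.1 hu) hx.le_right hx.left_le
    fun c hc h => ha ⟨c, hc, h⟩

theorem not_rightBlocked {x : Particle n → ℤ} {a : Particle n}
    (hx : IsPattern (jumpRight x a)) : ¬ RightBlocked x a := by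
  rintro ⟨c, hc, h⟩
  have h1 := hx.left_le c a hc
  have h2 : jumpRight x a c = x c := isStep_rightBelow.push_of_row_lt (by
    have := isStep_leftBelow.row_eq _ _ hc; omega)
  have h3 : jumpRight x a a = x a + 1 := IsStep.push_self x a
  omega

theorem isPattern_jumpLeft {x : Particle n → ℤ} (hx : IsPattern x) {a : Particle n}
    (ha : ¬ LeftBlocked x a) : IsPattern (jumpLeft x a) := by
  simp only [LeftBlocked, not_or, not_exists, not_and] at ha
  rw [jumpLeft_eq]
  have hR : ∀ c d, LeftBelow c d → (-x) c ≤ (-x) d := fun c d h => neg_le_neg (hx.left_le c d h)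
  have hL : ∀ c d, RightBelow c d → (-x) d ≤ (-x) c := fun c d h => neg_le_neg (hx.le_right c d h)
  refine ⟨fun b => ?_, fun c d h => neg_le_neg ?_, fun c d h => neg_le_neg (push_mono hR a c d h)⟩
  · have h0 := hx.nonneg b
    by_cases hb : ReflTransGen (Pushes LeftBelow (-x)) a b
    · have h1 := eq_of_reflTransGen hb
      have h2 := hx.nonneg a
      have h3 := ha.1
      rw [Pi.neg_apply, (IsStep.reflTransGen_iff _ _ _).1 hb]
      simp only [Pi.neg_apply] at h1 ⊢
      omega
    · have h1 : push LeftBelow (-x) a b = (-x) b := if_neg hb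
      rw [Pi.neg_apply, h1]
      simpa using h0
  · exact push_left_le (fun e u d _ h hu _ => exists_above_left e u d h.1 hu) hR hL (fun c hc h' => ha.2 c hc (neg_inj.1 h')) c d h

theorem not_leftBlocked {x : Particle n → ℤ} {a : Particle n}
    (hx : IsPattern (jumpLeft x a)) : ¬ LeftBlocked x a := by
  have h3 : jumpLeft x a a = x a - 1 := by
    rw [jumpLeft_eq, Pi.neg_apply, IsStep.push_self, Pi.neg_apply]; ring
  rintro (h | ⟨c, hc, h⟩)
  · have := hx.nonneg a
    omega
  · have h1 := hx.le_right c a hc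
    have h2 : jumpLeft x a c = x c := by
      rw [jumpLeft_eq, Pi.neg_apply, isStep_leftBelow.push_of_row_lt, Pi.neg_apply, neg_neg]
      have := isStep_rightBelow.row_eq _ _ hc
      omega
    omega

/-! ### Rates and weights -/

/-- The rate of a right jump in row `r`, and `1` in row `n + 1`. -/
noncomputable def rowRate (n : ℕ) (q : ℕ → ℝ) (r : ℤ) : ℝ :=
  if 1 ≤ r ∧ r ≤ n then
    if Odd r.toNat then q ((r.toNat + 1) / 2) else (q ((r.toNat + 1) / 2))⁻¹
  else 1

theorem rowRate_pos {q : ℕ → ℝ} (hq : ∀ i, 1 ≤ i → i ≤ (n + 1) / 2 → 0 < q i) (r : ℤ) :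
    0 < rowRate n q r := by
  unfold rowRate
  split_ifs with h
  · exact hq _ (by omega) (by omega)
  · exact inv_pos.2 (hq _ (by omega) (by omega))
  · exact one_pos

theorem rowRate_natCast {q : ℕ → ℝ} {r : ℕ} (h : 1 ≤ r ∧ r ≤ n) :
    rowRate n q r = if Odd r then q ((r + 1) / 2) else (q ((r + 1) / 2))⁻¹ := by
  rw [rowRate, if_pos (by omega), Int.toNat_natCast]

theorem rightRate_eq (q : ℕ → ℝ) (a : Particle n) : rightRate q a = rowRate n q a.level := by
  have := a.bounds
  rw [Particle.level, rowRate_natCast (by omega), rightRate]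

theorem leftRate_eq (q : ℕ → ℝ) (a : Particle n) : leftRate q a = (rowRate n q a.level)⁻¹ := by
  have := a.bounds
  rw [Particle.level, rowRate_natCast (by omega), leftRate]
  split_ifs <;> simp

/-- Summation by parts over the rows; the boundary terms vanish because row `0` has sum `0` and the
rate in row `n + 1` is `1`. -/
theorem weight_eq {q : ℕ → ℝ} (hq : ∀ i, 1 ≤ i → i ≤ (n + 1) / 2 → 0 < q i) (x : Pattern n) :
    weight q x = levelWeight Particle.level (rowRate n q) x.1 := by
  have hG : ∀ r, rowRate n q r ≠ 0 := fun r => (rowRate_pos hq r).ne'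
  have hsum : ∀ (g : ℝ) (_ : g ≠ 0) (s : Finset (Particle n)) (f : Particle n → ℤ),
      g ^ (∑ e ∈ s, f e) = ∏ e ∈ s, g ^ f e := by
    intro g hg s f
    classical
    induction s using Finset.induction_on with
    | empty => simp
    | insert a s ha ih => rw [Finset.sum_insert ha, Finset.prod_insert ha, zpow_add₀ hg, ih]
  have h0 : rowSum x 0 = 0 := by
    refine Finset.sum_eq_zero fun e he => ?_
    have := e.bounds
    have := (Finset.mem_filter.1 he).2
    omega
  have h1 : weight q x =
      ∏ r ∈ Finset.Icc 1 n, rowRate n q (r : ℕ) ^ (rowSum x r - rowSum x (r - 1)) := by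
    refine Finset.prod_congr rfl fun r hr => ?_
    rw [rowRate_natCast (Finset.mem_Icc.1 hr)]
    split_ifs
    · rfl
    · rw [inv_zpow', neg_sub]
  have h2 : ∏ r ∈ Finset.Icc 1 n, rowRate n q (r : ℕ) ^ (rowSum x (r - 1)) =
      ∏ r ∈ Finset.Icc 1 n, rowRate n q ((r : ℕ) + 1) ^ (rowSum x r) := by
    have e : Finset.Icc 1 n = Finset.Ico 1 (n + 1) := by ext; simp
    have e1 : rowRate n q ((n : ℕ) + 1) = 1 := by
      rw [rowRate, if_neg (by omega)]
    rw [e, Finset.prod_Ico_eq_prod_range, Finset.prod_Ico_eq_prod_range, Nat.add_sub_cancel]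
    rcases n with _ | m
    · simp
    · rw [Finset.prod_range_succ', Finset.prod_range_succ]
      have e2 : rowSum x (1 + 0 - 1) = 0 := h0
      rw [e2, show 1 + m = m + 1 by ring, e1, one_zpow, zpow_zero]
      congr 1
  rw [h1]
  simp_rw [zpow_sub₀ (hG _)]
  rw [Finset.prod_div_distrib, h2, ← Finset.prod_div_distrib]
  simp_rw [← div_zpow]
  rw [levelWeight, ← Finset.prod_fiberwise_of_maps_to (s := Finset.univ) (t := Finset.Icc 1 n)
    (g := fun e : Particle n => e.row)
    (fun e _ => Finset.mem_Icc.2 ⟨e.bounds.1, e.bounds.2.1⟩)]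
  refine Finset.prod_congr rfl fun r _ => ?_
  rw [rowSum, hsum _ (div_ne_zero (hG _) (hG _))]
  refine Finset.prod_congr rfl fun e he => ?_
  rw [Particle.level, (Finset.mem_filter.1 he).2]

end SymplecticGT

namespace SymplecticGT

open Relation

variable {n : ℕ}

/-! ### Moving the last particle of a chain backwards -/

theorem IsStep.unpush_of_row_le {S : Type*} {R : S → S → Prop} {row : S → ℤ} (hR : IsStep R row)
    (x : S → ℤ) {b e : S} (h : row b ≤ row e) (hne : e ≠ b) : unpush R x b e = x e := by
  have h1 : push (_root_.flip R) (-x) b e = (-x) e :=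
    if_neg fun h' => hne (hR.flip.eq_of_row_le h' (neg_le_neg h)).symm
  rw [unpush, Pi.neg_apply, h1, Pi.neg_apply, neg_neg]

theorem unpush_self {S : Type*} (R : S → S → Prop) (x : S → ℤ) (b : S) :
    unpush R x b b = x b - 1 := by
  rw [unpush, Pi.neg_apply, IsStep.push_self, Pi.neg_apply]; ring

/-- The mirror image of `exists_above_right`, needed for chains that move back upwards. It fails in
the bottom row, which has nothing below it. -/
theorem exists_below_right {e u d : Particle n} (h1 : RightBelow d e) (h2 : LeftBelow d u)
    (he : e.row ≠ n) : ∃ v, LeftBelow e v ∧ RightBelow u v := by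
  obtain ⟨h1, h3⟩ := h1
  obtain ⟨h2, h4⟩ := h2
  have hr : u.row = e.row := by omega
  have hi : e.idx = u.idx + 1 := by rw [h1] at hr; omega
  have hd := d.bounds
  have he' := e.bounds
  have hu := u.bounds
  obtain ⟨v, hv1, hv2⟩ := Particle.exists_of_bounds (n := n) (r := e.row + 1)
    (i := e.idx - e.row % 2) (by omega)
  exact ⟨v, ⟨by omega, by omega⟩, by omega, by omega⟩

theorem exists_rightBelow {e : Particle n} (he : e.row ≠ n) : ∃ v, RightBelow e v := by
  have h := e.bounds
  obtain ⟨v, hv1, hv2⟩ := Particle.exists_of_bounds (n := n) (r := e.row + 1)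
    (i := e.idx + (e.row + 1) % 2) (by omega)
  exact ⟨v, hv1, hv2⟩

/-- `h1` keeps the reversed chain off the wall and `h2` keeps `b` ahead of its neighbour below. `h3`
replaces, in the bottom row, the missing lower particle that would separate `b` from its left
neighbour. -/
theorem isPattern_unpush_rightBelow {x : Particle n → ℤ} (hx : IsPattern x) {b : Particle n}
    (h1 : 1 ≤ x b) (h2 : ∀ f, LeftBelow b f → x f < x b)
    (h3 : b.row = n → ∀ u : Particle n, u.row = n → u.idx + 1 = b.idx → x u < x b) :
    IsPattern (unpush RightBelow x b) := by
  have hR : ∀ c d, flip RightBelow c d → (-x) c ≤ (-x) d := fun c d h =>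
    neg_le_neg (hx.le_right d c h)
  have hL : ∀ c d, flip LeftBelow c d → (-x) d ≤ (-x) c := fun c d h =>
    neg_le_neg (hx.left_le d c h)
  refine ⟨fun e => ?_, fun c d h => neg_le_neg (push_mono hR b d c h),
    fun c d h => neg_le_neg (push_left_le ?_ hR hL (fun f hf => ?_) d c h)⟩
  · have h0 := hx.nonneg e
    rw [unpush, Pi.neg_apply]
    by_cases he : ReflTransGen (Pushes (flip RightBelow) (-x)) b e
    · have := eq_of_reflTransGen he
      rw [(IsStep.reflTransGen_iff _ _ _).1 he]
      simp only [Pi.neg_apply] at this ⊢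
      omega
    · have h4 : push (flip RightBelow) (-x) b e = (-x) e := if_neg he
      rw [h4, Pi.neg_apply]
      omega
  · intro e u d he hed hud hxd
    by_cases hn : e.row = n
    · exfalso
      -- A reversed chain only goes up from `b`, so it meets row `n` only at `b` itself.
      have hb := b.bounds
      have hle := isStep_rightBelow.flip.row_le he
      have heb : b = e := isStep_rightBelow.flip.eq_of_row_le he (by
        simp only [Pi.neg_apply, Particle.level] at hle ⊢; omega)
      subst heb
      have hur := hud.1
      have hui := hud.2
      have hbr := hed.1.1
      have hbi := hed.1.2
      have h5 := h3 hn u (by omega) (by omega)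
      have h6 := hed.2
      simp only [Pi.neg_apply] at h6 hxd
      omega
    · exact exists_below_right hed.1 hud hn
  · have := h2 f hf
    simp only [Pi.neg_apply]
    omega

theorem isPattern_neg_unpush_leftBelow {x : Particle n → ℤ} (hx : IsPattern x) {b : Particle n}
    (h2 : ∀ f, RightBelow b f → x b < x f)
    (h3 : b.row = n → ∀ u : Particle n, u.row = n → u.idx = b.idx + 1 → x b < x u) :
    IsPattern (-unpush LeftBelow (-x) b) := by
  have e : -unpush LeftBelow (-x) b = push (flip LeftBelow) x b := by
    rw [unpush, neg_neg, neg_neg]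
  rw [e]
  have hR : ∀ c d, flip LeftBelow c d → x c ≤ x d := fun c d h => hx.left_le d c h
  have hL : ∀ c d, flip RightBelow c d → x d ≤ x c := fun c d h => hx.le_right d c h
  refine ⟨fun e => (hx.nonneg e).trans (IsStep.le_push x b e),
    fun c d h => push_left_le ?_ hR hL (fun f hf => (h2 f hf).ne') d c h,
    fun c d h => push_mono hR b d c h⟩
  intro e u d he hed hud hxd
  by_cases hn : e.row = n
  · exfalso
    have hb := b.bounds
    have hle := isStep_leftBelow.flip.row_le he
    have heb : b = e := isStep_leftBelow.flip.eq_of_row_le he (by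
      simp only [Pi.neg_apply, Particle.level] at hle ⊢; omega)
    subst heb
    have hur := hud.1
    have hui := hud.2
    have hbr := hed.1.1
    have hbi := hed.1.2
    have h5 := h3 hn u (by omega) (by omega)
    have h6 := hed.2
    omega
  · have hu := u.bounds
    have hur := hud.1
    have hbr := hed.1.1
    obtain ⟨v, h5, h6⟩ := exists_below_right hud hed.1 (by omega)
    exact ⟨v, h6, h5⟩

theorem isPattern_unpush_rightBelow_iff {x : Particle n → ℤ} (hx : IsPattern x) {b : Particle n}
    (hb : b.row ≠ n) :
    IsPattern (unpush RightBelow x b) ↔ 1 ≤ x b ∧ ∀ f, LeftBelow b f → x f < x b := by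
  refine ⟨fun h => ?_, fun h => isPattern_unpush_rightBelow hx h.1 h.2 fun h' => absurd h' hb⟩
  have h1 := unpush_self RightBelow x b
  refine ⟨by have := h.nonneg b; omega, fun f hf => ?_⟩
  have h2 := h.left_le b f hf
  have h3 := isStep_leftBelow.row_eq b f hf
  rw [h1, isStep_rightBelow.unpush_of_row_le x (by omega) (by rintro rfl; omega)] at h2
  omega

theorem isPattern_neg_unpush_leftBelow_iff {x : Particle n → ℤ} (hx : IsPattern x)
    {b : Particle n} (hb : b.row ≠ n) :
    IsPattern (-unpush LeftBelow (-x) b) ↔ ∀ f, RightBelow b f → x b < x f := by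
  refine ⟨fun h f hf => ?_, fun h => isPattern_neg_unpush_leftBelow hx h fun h' => absurd h' hb⟩
  have h1 := unpush_self LeftBelow (-x) b
  have h2 := h.le_right b f hf
  have h3 := isStep_rightBelow.row_eq b f hf
  rw [Pi.neg_apply, Pi.neg_apply, h1,
    isStep_leftBelow.unpush_of_row_le (-x) (by omega) (by rintro rfl; omega)] at h2
  simp only [Pi.neg_apply] at h2
  omega

/-! ### The patterns with a given bottom row -/

theorem row_bottomParticle (i : Fin ((n + 1) / 2)) : (bottomParticle n i).row = n := rfl

theorem idx_bottomParticle (i : Fin ((n + 1) / 2)) : (bottomParticle n i).idx = i + 1 := rfl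

theorem bottomParticle_injective : Function.Injective (bottomParticle n) := fun i j h =>
  Fin.ext (by have := congrArg Particle.idx h; simpa [idx_bottomParticle] using this)

theorem exists_eq_bottomParticle {a : Particle n} (h : a.row = n) : ∃ i, a = bottomParticle n i := by
  have := a.bounds
  exact ⟨⟨a.idx - 1, by omega⟩, Particle.ext_row_idx h (by rw [idx_bottomParticle]; simp; omega)⟩

/-- Following right neighbours down to row `n` can only increase the entry. -/
theorem IsPattern.le_of_bottom {x : Particle n → ℤ} (hx : IsPattern x) {M : ℤ}
    (hM : ∀ i, x (bottomParticle n i) ≤ M) (a : Particle n) : x a ≤ M := by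
  induction hk : n - a.row using Nat.strong_induction_on generalizing a with
  | _ k ih =>
    by_cases h : a.row = n
    · obtain ⟨i, rfl⟩ := exists_eq_bottomParticle h
      exact hM i
    · obtain ⟨b, hb⟩ := exists_rightBelow h
      have h1 := a.bounds
      have h2 := hb.1
      exact (hx.le_right a b hb).trans (ih _ (by omega) b rfl)

theorem finite_fiber (z : Chamber ((n + 1) / 2)) : {x : Pattern n | bottomRow x = z}.Finite := by
  obtain ⟨M, hM⟩ := (Set.finite_range z.1).bddAbove
  refine Set.Finite.of_finite_image (f := Subtype.val) (Set.Finite.subset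
    (Set.Finite.pi' fun _ : Particle n => Set.finite_Icc (0 : ℤ) M) ?_) Subtype.val_injective.injOn
  rintro _ ⟨x, rfl, rfl⟩ a
  exact ⟨x.2.nonneg a, x.2.le_of_bottom (fun i => hM ⟨i, rfl⟩) a⟩

/-- Fill each row with the largest entries of `z`; right neighbours are then equal. -/
theorem exists_bottomRow_eq (z : Chamber ((n + 1) / 2)) : ∃ x : Pattern n, bottomRow x = z := by
  have hlt : ∀ a : Particle n, a.idx - 1 + ((n + 1) / 2 - (a.row + 1) / 2) < (n + 1) / 2 := by
    intro a
    have := a.bounds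
    omega
  refine ⟨⟨fun a => z.1 ⟨_, hlt a⟩, fun a => z.2.2 _, fun a b h => z.2.1 ?_,
    fun a b h => z.2.1 ?_⟩, Subtype.ext (funext fun i => ?_)⟩
  · have := a.bounds
    have := h.1
    have := h.2
    rw [Fin.mk_le_mk]
    omega
  · have := a.bounds
    have := b.bounds
    have := h.1
    have := h.2
    rw [Fin.mk_le_mk]
    omega
  · simp only [bottomRow]
    refine congrArg z.1 (Fin.ext ?_)
    simp only [row_bottomParticle, idx_bottomParticle]
    omega

/-- The patterns with bottom row `z`. -/
noncomputable def fiber (z : Chamber ((n + 1) / 2)) : Finset (Pattern n) := (finite_fiber z).toFinset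

@[simp] theorem mem_fiber {z : Chamber ((n + 1) / 2)} {x : Pattern n} :
    x ∈ fiber z ↔ bottomRow x = z := by simp [fiber]

/-! ### Symplectic Schur functions and the initial law -/

variable {q : ℕ → ℝ}

theorem weight_pos (hq : ∀ i, 1 ≤ i → i ≤ (n + 1) / 2 → 0 < q i) (x : Pattern n) :
    0 < weight q x := by
  rw [weight_eq hq]
  exact Finset.prod_pos fun e _ => zpow_pos (div_pos (rowRate_pos hq _) (rowRate_pos hq _)) _

theorem sp_eq_sum (q : ℕ → ℝ) (z : Chamber ((n + 1) / 2)) :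
    Sp n q z = ∑ x ∈ fiber z, weight q x := by
  rw [Sp, ← Finset.tsum_subtype]
  have : ((fiber z : Finset (Pattern n)) : Set (Pattern n)) = {x | bottomRow x = z} := by
    ext x; simp
  exact (tsum_congr_set_coe (weight q) this).symm

theorem sp_pos (hq : ∀ i, 1 ≤ i → i ≤ (n + 1) / 2 → 0 < q i) (z : Chamber ((n + 1) / 2)) :
    0 < Sp n q z := by
  rw [sp_eq_sum]
  obtain ⟨x, hx⟩ := exists_bottomRow_eq z
  exact Finset.sum_pos (fun x _ => weight_pos hq x) ⟨x, mem_fiber.2 hx⟩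

theorem initialLaw_nonneg (hq : ∀ i, 1 ≤ i → i ≤ (n + 1) / 2 → 0 < q i)
    (z : Chamber ((n + 1) / 2)) (x : Pattern n) : 0 ≤ initialLaw n q z x := by
  unfold initialLaw
  split_ifs
  · exact div_nonneg (weight_pos hq x).le (sp_pos hq z).le
  · exact le_rfl

theorem hasSum_initialLaw_mul (q : ℕ → ℝ) (z : Chamber ((n + 1) / 2)) (f : Pattern n → ℝ) :
    HasSum (fun x => initialLaw n q z x * f x)
      ((∑ x ∈ fiber z, weight q x * f x) / Sp n q z) := by
  have h : (∑ x ∈ fiber z, weight q x * f x) / Sp n q z =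
      ∑ x ∈ fiber z, initialLaw n q z x * f x := by
    rw [Finset.sum_div]
    refine Finset.sum_congr rfl fun x hx => ?_
    rw [initialLaw, if_pos (mem_fiber.1 hx)]
    ring
  rw [h]
  refine hasSum_sum_of_ne_finset_zero fun x hx => ?_
  rw [initialLaw, if_neg (fun h => hx (mem_fiber.2 h)), zero_mul]

theorem hasSum_initialLaw (hq : ∀ i, 1 ≤ i → i ≤ (n + 1) / 2 → 0 < q i)
    (z : Chamber ((n + 1) / 2)) : HasSum (initialLaw n q z) 1 := by
  have h := hasSum_initialLaw_mul q z fun _ => 1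
  simpa [← sp_eq_sum, div_self (sp_pos hq z).ne'] using h

/-! ### The `Q`-matrix of the process of patterns -/

theorem jumpRight_ne (x : Particle n → ℤ) (a : Particle n) : x ≠ jumpRight x a := fun h => by
  have h1 := congrFun h a
  rw [jumpRight_eq, IsStep.push_self] at h1
  omega

theorem jumpLeft_ne (x : Particle n → ℤ) (a : Particle n) : x ≠ jumpLeft x a := fun h => by
  have h1 := congrFun h a
  rw [jumpLeft_eq, Pi.neg_apply, IsStep.push_self, Pi.neg_apply] at h1
  omega

-- The blocking conditions can be dropped: a blocked jump would leave the set of patterns, so it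
-- never equals `y`. The jump sums are then in the form required by `IsStep.sum_push`.
open scoped Classical in
theorem patternQ_eq (q : ℕ → ℝ) (x y : Pattern n) :
    patternQ n q x y = (if x = y then patternQ n q x x else 0) +
      ((∑ a, if y.1 = jumpRight x.1 a then rightRate q a else 0) +
        ∑ a, if y.1 = jumpLeft x.1 a then leftRate q a else 0) := by
  by_cases h : x = y
  · subst h
    simp [jumpRight_ne, jumpLeft_ne]
  · rw [if_neg h, zero_add, patternQ, if_neg h, ← Finset.sum_add_distrib]
    refine Finset.sum_congr rfl fun a _ => ?_
    congr 1
    · refine if_congr ⟨And.right, fun h => ⟨not_rightBlocked (h ▸ y.2), h⟩⟩ rfl rfl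
    · refine if_congr ⟨And.right, fun h => ⟨not_leftBlocked (h ▸ y.2), h⟩⟩ rfl rfl

theorem isConservative_patternQ (hq : ∀ i, 1 ≤ i → i ≤ (n + 1) / 2 → 0 < q i) :
    IsConservative (patternQ n q) where
  nonneg x y h := by
    classical
    rw [patternQ_eq, if_neg h, zero_add]
    refine add_nonneg (Finset.sum_nonneg fun a _ => ?_) (Finset.sum_nonneg fun a _ => ?_)
    · rw [rightRate_eq]
      split_ifs
      exacts [(rowRate_pos hq _).le, le_rfl]
    · rw [leftRate_eq]
      split_ifs
      exacts [(inv_pos.2 (rowRate_pos hq _)).le, le_rfl]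
  hasSum_zero x := by
    classical
    have hR : ∀ a : Particle n, HasSum
        (fun y : Pattern n => if y.1 = jumpRight x.1 a then rightRate q a else 0)
        (if RightBlocked x.1 a then 0 else rightRate q a) := by
      intro a
      split_ifs with h
      · convert hasSum_zero with y
        exact if_neg fun h' => not_rightBlocked (h' ▸ y.2) h
      · convert hasSum_ite_eq (⟨jumpRight x.1 a, isPattern_jumpRight x.2 h⟩ : Pattern n)
          (rightRate q a) using 3 with y
        exact (Subtype.ext_iff (a2 := ⟨_, _⟩)).symm
    have hL : ∀ a : Particle n, HasSum
        (fun y : Pattern n => if y.1 = jumpLeft x.1 a then leftRate q a else 0)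
        (if LeftBlocked x.1 a then 0 else leftRate q a) := by
      intro a
      split_ifs with h
      · convert hasSum_zero with y
        exact if_neg fun h' => not_leftBlocked (h' ▸ y.2) h
      · convert hasSum_ite_eq (⟨jumpLeft x.1 a, isPattern_jumpLeft x.2 h⟩ : Pattern n)
          (leftRate q a) using 3 with y
        exact (Subtype.ext_iff (a2 := ⟨_, _⟩)).symm
    have h := (hasSum_ite_eq x (patternQ n q x x)).add
      ((hasSum_sum (s := Finset.univ) fun a _ => hR a).add
        (hasSum_sum (s := Finset.univ) fun a _ => hL a))
    convert h using 1
    · funext y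
      rw [patternQ_eq]
      simp only [eq_comm]
    · rw [patternQ, if_pos rfl, Finset.sum_add_distrib]
      ring

theorem neg_patternQ_self_le (hq : ∀ i, 1 ≤ i → i ≤ (n + 1) / 2 → 0 < q i) (x : Pattern n) :
    -patternQ n q x x ≤ ∑ a : Particle n, (rightRate q a + leftRate q a) := by
  rw [patternQ, if_pos rfl, neg_neg]
  refine Finset.sum_le_sum fun a _ => add_le_add ?_ ?_
  · rw [rightRate_eq]
    split_ifs
    exacts [(rowRate_pos hq _).le, le_rfl]
  · rw [leftRate_eq]
    split_ifs
    exacts [(inv_pos.2 (rowRate_pos hq _)).le, le_rfl]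

end SymplecticGT

namespace SymplecticGT

open Relation

variable {n : ℕ} {q : ℕ → ℝ}

/-! ### Reversal of the dynamics of patterns -/

theorem levelWeight_inv_neg {S : Type*} [Fintype S] (row : S → ℤ) (G : ℤ → ℝ) (x : S → ℤ) :
    levelWeight row (fun r => (G r)⁻¹) (-x) = levelWeight row G x := by
  refine Finset.prod_congr rfl fun e _ => ?_
  rw [Pi.neg_apply, inv_div_inv, zpow_neg, ← inv_zpow, inv_div]

open scoped Classical in
theorem sum_fiber_jumpRight (hq : ∀ i, 1 ≤ i → i ≤ (n + 1) / 2 → 0 < q i)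
    (z : Chamber ((n + 1) / 2)) (x : Pattern n) :
    ∑ y ∈ fiber z, weight q y * ∑ a, (if x.1 = jumpRight y.1 a then rightRate q a else 0) =
      weight q x * ∑ b, if ∃ y, bottomRow y = z ∧ y.1 = unpush RightBelow x.1 b
        then rowRate n q (b.level + 1) else 0 := by
  have h := isStep_rightBelow.sum_push ((fiber z).map ⟨Subtype.val, Subtype.val_injective⟩)
    (fun y hy => by
      obtain ⟨y, _, rfl⟩ := Finset.mem_map.1 hy
      exact y.2.le_right) x.2.le_right (fun r => (rowRate_pos hq r).ne')
  rw [Finset.sum_map] at h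
  rw [weight_eq hq x]
  convert h using 2 with y _
  · rw [weight_eq hq y, Finset.mul_sum]
    refine Finset.sum_congr rfl fun a _ => ?_
    rw [rightRate_eq, mul_ite, mul_zero]
    rfl
  · refine Finset.sum_congr rfl fun b _ => if_congr ?_ rfl rfl
    simp

-- Negating configurations turns left jumps into upward pushes along `LeftBelow`; inverting the
-- rates at the same time leaves the weight unchanged.
open scoped Classical in
theorem sum_fiber_jumpLeft (hq : ∀ i, 1 ≤ i → i ≤ (n + 1) / 2 → 0 < q i)
    (z : Chamber ((n + 1) / 2)) (x : Pattern n) :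
    ∑ y ∈ fiber z, weight q y * ∑ a, (if x.1 = jumpLeft y.1 a then leftRate q a else 0) =
      weight q x * ∑ b, if ∃ y, bottomRow y = z ∧ y.1 = -unpush LeftBelow (-x.1) b
        then (rowRate n q (b.level + 1))⁻¹ else 0 := by
  have h := isStep_leftBelow.sum_push
    ((fiber z).map ⟨fun y => -y.1, fun y y' h => Subtype.ext (neg_injective h)⟩)
    (fun y hy => by
      obtain ⟨y, _, rfl⟩ := Finset.mem_map.1 hy
      exact fun c d h => neg_le_neg (y.2.left_le c d h)) (x := -x.1)
    (fun c d h => neg_le_neg (x.2.left_le c d h))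
    (G := fun r => (rowRate n q r)⁻¹) (fun r => (inv_pos.2 (rowRate_pos hq r)).ne')
  rw [Finset.sum_map, levelWeight_inv_neg] at h
  rw [weight_eq hq x]
  convert h using 2 with y _
  · rw [weight_eq hq y, Finset.mul_sum]
    refine Finset.sum_congr rfl fun a _ => ?_
    rw [leftRate_eq, mul_ite, mul_zero, jumpLeft_eq]
    change _ = if _ = push LeftBelow (-y.1) a then levelWeight _ _ (-y.1) * _ else _
    rw [levelWeight_inv_neg]
    refine if_congr ?_ rfl rfl
    rw [neg_eq_iff_eq_neg]
  · refine Finset.sum_congr rfl fun b _ => if_congr ?_ rfl rfl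
    simp only [Finset.mem_map, mem_fiber]
    exact exists_congr fun y => and_congr_right fun _ => neg_eq_iff_eq_neg.symm

/-- A reversed chain starting above row `n` leaves the bottom row unchanged. -/
theorem exists_unpush_right_iff {x : Pattern n} {z : Chamber ((n + 1) / 2)} {b : Particle n}
    (hb : b.row ≠ n) : (∃ y, bottomRow y = z ∧ y.1 = unpush RightBelow x.1 b) ↔
      bottomRow x = z ∧ 1 ≤ x.1 b ∧ ∀ f, LeftBelow b f → x.1 f < x.1 b := by
  rw [← isPattern_unpush_rightBelow_iff x.2 hb]
  have h : ∀ i, unpush RightBelow x.1 b (bottomParticle n i) = x.1 (bottomParticle n i) := fun i =>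
    isStep_rightBelow.unpush_of_row_le x.1
      (by have := b.bounds; simp only [Particle.level, row_bottomParticle]; omega)
      (fun h => hb (h ▸ row_bottomParticle i))
  constructor
  · rintro ⟨y, rfl, hy⟩
    refine ⟨Subtype.ext (funext fun i => ?_), hy ▸ y.2⟩
    have := h i
    rw [← hy] at this
    exact this.symm
  · rintro ⟨rfl, hy⟩
    exact ⟨⟨_, hy⟩, Subtype.ext (funext h), rfl⟩

theorem exists_unpush_left_iff {x : Pattern n} {z : Chamber ((n + 1) / 2)} {b : Particle n}
    (hb : b.row ≠ n) : (∃ y, bottomRow y = z ∧ y.1 = -unpush LeftBelow (-x.1) b) ↔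
      bottomRow x = z ∧ ∀ f, RightBelow b f → x.1 b < x.1 f := by
  rw [← isPattern_neg_unpush_leftBelow_iff x.2 hb]
  have h : ∀ i, (-unpush LeftBelow (-x.1) b) (bottomParticle n i) = x.1 (bottomParticle n i) := by
    intro i
    rw [Pi.neg_apply, isStep_leftBelow.unpush_of_row_le (-x.1) (b := b) (e := bottomParticle n i)
      (by have := b.bounds; simp only [Particle.level, row_bottomParticle]; omega)
      (fun h => hb (h ▸ row_bottomParticle i)), Pi.neg_apply, neg_neg]
  constructor
  · rintro ⟨y, rfl, hy⟩
    refine ⟨Subtype.ext (funext fun i => ?_), hy ▸ y.2⟩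
    have := h i
    rw [← hy] at this
    exact this.symm
  · rintro ⟨rfl, hy⟩
    exact ⟨⟨_, hy⟩, Subtype.ext (funext h), rfl⟩

/-- The conditions for the reversed move to give a pattern hold automatically, because the target
`z` already lies in the chamber. -/
theorem exists_unpush_right_bottom_iff {x : Pattern n} {z : Chamber ((n + 1) / 2)}
    (i : Fin ((n + 1) / 2)) :
    (∃ y, bottomRow y = z ∧ y.1 = unpush RightBelow x.1 (bottomParticle n i)) ↔
      (bottomRow x).1 = z.1 + Pi.single i 1 := by
  have h : ∀ j, unpush RightBelow x.1 (bottomParticle n i) (bottomParticle n j) =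
      (bottomRow x).1 j - (Pi.single i 1 : Fin ((n + 1) / 2) → ℤ) j := by
    intro j
    by_cases hij : j = i
    · subst hij
      rw [unpush_self, Pi.single_eq_same]
      rfl
    · rw [isStep_rightBelow.unpush_of_row_le x.1 (b := bottomParticle n i) (e := bottomParticle n j) le_rfl
        (fun h => hij (bottomParticle_injective h)), Pi.single_eq_of_ne hij, sub_zero]
      rfl
  constructor
  · rintro ⟨y, rfl, hy⟩
    funext j
    have := h j
    rw [← hy] at this
    change _ = y.1 (bottomParticle n j) + _
    rw [this, sub_add_cancel]
  · intro hz
    have hx : ∀ j, x.1 (bottomParticle n j) = z.1 j + (Pi.single i 1 : Fin _ → ℤ) j := congrFun hz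
    have hxi := hx i
    rw [Pi.single_eq_same] at hxi
    have hzi := z.2.2 i
    refine ⟨⟨_, isPattern_unpush_rightBelow x.2 (by omega) (fun f hf => ?_) fun _ u hu hui => ?_⟩,
      Subtype.ext (funext fun j => (h j).trans ?_), rfl⟩
    · have h1 := f.bounds
      have h2 := hf.1
      rw [row_bottomParticle] at h2
      omega
    · obtain ⟨j, rfl⟩ := exists_eq_bottomParticle hu
      rw [idx_bottomParticle, idx_bottomParticle] at hui
      have hji : j ≠ i := by rintro rfl; omega
      have hxj := hx j
      rw [Pi.single_eq_of_ne hji] at hxj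
      have := z.2.1 (show j ≤ i from Fin.le_def.2 (by omega))
      omega
    · rw [hz, Pi.add_apply, add_sub_cancel_right]

theorem exists_unpush_left_bottom_iff {x : Pattern n} {z : Chamber ((n + 1) / 2)}
    (i : Fin ((n + 1) / 2)) :
    (∃ y, bottomRow y = z ∧ y.1 = -unpush LeftBelow (-x.1) (bottomParticle n i)) ↔
      (bottomRow x).1 = z.1 - Pi.single i 1 := by
  have h : ∀ j, (-unpush LeftBelow (-x.1) (bottomParticle n i)) (bottomParticle n j) =
      (bottomRow x).1 j + (Pi.single i 1 : Fin ((n + 1) / 2) → ℤ) j := by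
    intro j
    rw [Pi.neg_apply]
    by_cases hij : j = i
    · subst hij
      rw [unpush_self, Pi.single_eq_same, neg_sub, Pi.neg_apply, sub_neg_eq_add, add_comm]
      rfl
    · rw [isStep_leftBelow.unpush_of_row_le (-x.1) (b := bottomParticle n i) (e := bottomParticle n j) le_rfl
        (fun h => hij (bottomParticle_injective h)), Pi.single_eq_of_ne hij, add_zero,
        Pi.neg_apply, neg_neg]
      rfl
  constructor
  · rintro ⟨y, rfl, hy⟩
    funext j
    have := h j
    rw [← hy] at this
    change _ = y.1 (bottomParticle n j) - _
    rw [this, add_sub_cancel_right]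
  · intro hz
    have hx : ∀ j, x.1 (bottomParticle n j) = z.1 j - (Pi.single i 1 : Fin _ → ℤ) j := congrFun hz
    have hxi := hx i
    rw [Pi.single_eq_same] at hxi
    refine ⟨⟨_, isPattern_neg_unpush_leftBelow x.2 (fun f hf => ?_) fun _ u hu hui => ?_⟩,
      Subtype.ext (funext fun j => (h j).trans ?_), rfl⟩
    · have h1 := f.bounds
      have h2 := hf.1
      rw [row_bottomParticle] at h2
      omega
    · obtain ⟨j, rfl⟩ := exists_eq_bottomParticle hu
      rw [idx_bottomParticle, idx_bottomParticle] at hui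
      have hji : j ≠ i := by rintro rfl; omega
      have hxj := hx j
      rw [Pi.single_eq_of_ne hji] at hxj
      have := z.2.1 (show i ≤ j from Fin.le_def.2 (by omega))
      omega
    · rw [hz, Pi.sub_apply, sub_add_cancel]

theorem rowRate_level_add_one {b : Particle n} (hb : b.row = n) :
    rowRate n q (b.level + 1) = 1 := by
  rw [rowRate, if_neg]
  simp only [Particle.level, hb]
  omega

-- Only chains ending in the bottom row change it, and these carry the factor `G (n + 1) = 1`. At
-- most one index and one sign can connect `z` to the new bottom row, so the total is an indicator.
open scoped Classical in
theorem sum_unpush_of_ne {x : Pattern n} {z : Chamber ((n + 1) / 2)} (h : bottomRow x ≠ z) :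
    (∑ b, if ∃ y, bottomRow y = z ∧ y.1 = unpush RightBelow x.1 b
        then rowRate n q (b.level + 1) else 0) +
      (∑ b, if ∃ y, bottomRow y = z ∧ y.1 = -unpush LeftBelow (-x.1) b
        then (rowRate n q (b.level + 1))⁻¹ else 0) =
    if ∃ i, (bottomRow x).1 = z.1 + Pi.single i 1 ∨ (bottomRow x).1 = z.1 - Pi.single i 1
      then 1 else 0 := by
  have hR : ∀ b, (if ∃ y, bottomRow y = z ∧ y.1 = unpush RightBelow x.1 b
      then rowRate n q (b.level + 1) else 0) =
        if ∃ i, b = bottomParticle n i ∧ (bottomRow x).1 = z.1 + Pi.single i 1 then 1 else 0 := by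
    intro b
    by_cases hb : b.row = n
    · obtain ⟨i, rfl⟩ := exists_eq_bottomParticle hb
      by_cases hi : (bottomRow x).1 = z.1 + Pi.single i 1
      · rw [if_pos ((exists_unpush_right_bottom_iff i).2 hi), if_pos ⟨i, rfl, hi⟩,
          rowRate_level_add_one hb]
      · rw [if_neg (fun h => hi ((exists_unpush_right_bottom_iff i).1 h)), if_neg]
        rintro ⟨j, h1, h2⟩
        exact hi (by rwa [bottomParticle_injective h1])
    · rw [if_neg (fun h' => h ((exists_unpush_right_iff hb).1 h').1), if_neg]
      rintro ⟨i, rfl, _⟩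
      exact hb (row_bottomParticle i)
  have hL : ∀ b, (if ∃ y, bottomRow y = z ∧ y.1 = -unpush LeftBelow (-x.1) b
      then (rowRate n q (b.level + 1))⁻¹ else 0) =
        if ∃ i, b = bottomParticle n i ∧ (bottomRow x).1 = z.1 - Pi.single i 1 then 1 else 0 := by
    intro b
    by_cases hb : b.row = n
    · obtain ⟨i, rfl⟩ := exists_eq_bottomParticle hb
      by_cases hi : (bottomRow x).1 = z.1 - Pi.single i 1
      · rw [if_pos ((exists_unpush_left_bottom_iff i).2 hi), if_pos ⟨i, rfl, hi⟩,
          rowRate_level_add_one hb, inv_one]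
      · rw [if_neg (fun h => hi ((exists_unpush_left_bottom_iff i).1 h)), if_neg]
        rintro ⟨j, h1, h2⟩
        exact hi (by rwa [bottomParticle_injective h1])
    · rw [if_neg (fun h' => h ((exists_unpush_left_iff hb).1 h').1), if_neg]
      rintro ⟨i, rfl, _⟩
      exact hb (row_bottomParticle i)
  simp_rw [hR, hL]
  have hinj : ∀ i j : Fin ((n + 1) / 2), (Pi.single i 1 : Fin _ → ℤ) = Pi.single j 1 → i = j := by
    intro i j hij
    by_contra hne
    have := congrFun hij i
    rw [Pi.single_eq_same, Pi.single_eq_of_ne hne] at this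
    exact one_ne_zero this
  have hopp : ∀ i j : Fin ((n + 1) / 2), (Pi.single i 1 : Fin _ → ℤ) ≠ -Pi.single j 1 := by
    intro i j hij
    have := congrFun hij i
    rw [Pi.single_eq_same, Pi.neg_apply, Pi.single_apply] at this
    split_ifs at this
    all_goals omega
  by_cases hp : ∃ i, (bottomRow x).1 = z.1 + Pi.single i 1
  · obtain ⟨i, hi⟩ := hp
    rw [if_pos ⟨i, Or.inl hi⟩, Finset.sum_eq_single (bottomParticle n i), if_pos ⟨i, rfl, hi⟩,
      Finset.sum_eq_zero, add_zero]
    · refine fun b _ => if_neg ?_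
      rintro ⟨j, _, hj⟩
      exact hopp i j (by rw [hi, sub_eq_add_neg] at hj; exact add_left_cancel hj)
    · refine fun b _ hb => if_neg ?_
      rintro ⟨j, rfl, hj⟩
      exact hb (by rw [hinj i j (add_left_cancel (hi.symm.trans hj))])
    · exact fun h => absurd (Finset.mem_univ _) h
  · rw [Finset.sum_eq_zero (fun b _ => if_neg fun ⟨i, _, hi⟩ => hp ⟨i, hi⟩), zero_add]
    by_cases hm : ∃ i, (bottomRow x).1 = z.1 - Pi.single i 1
    · obtain ⟨i, hi⟩ := hm
      rw [if_pos ⟨i, Or.inr hi⟩, Finset.sum_eq_single (bottomParticle n i), if_pos ⟨i, rfl, hi⟩]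
      · refine fun b _ hb => if_neg ?_
        rintro ⟨j, rfl, hj⟩
        exact hb (by rw [hinj i j (sub_right_injective (hi.symm.trans hj))])
      · exact fun h => absurd (Finset.mem_univ _) h
    · rw [if_neg, Finset.sum_eq_zero (fun b _ => if_neg fun ⟨i, _, hi⟩ => hm ⟨i, hi⟩)]
      rintro ⟨i, hi | hi⟩
      exacts [hp ⟨i, hi⟩, hm ⟨i, hi⟩]

end SymplecticGT

namespace SymplecticGT

variable {n : ℕ} {q : ℕ → ℝ}

/-! ### The diagonal of the intertwining relation -/

theorem exists_leftBelow_iff (b : Particle n) :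
    (∃ f, LeftBelow b f) ↔ b.row ≠ n ∧ ¬ (Odd b.row ∧ b.idx = 1) := by
  have hb := b.bounds
  rw [Nat.odd_iff]
  constructor
  · rintro ⟨f, h1, h2⟩
    have hf := f.bounds
    omega
  · intro h
    obtain ⟨f, h1, h2⟩ := Particle.exists_of_bounds (n := n) (r := b.row + 1)
      (i := b.idx - b.row % 2) (by omega)
    exact ⟨f, h1, by omega⟩

theorem exists_rightBelow_iff (f : Particle n) :
    (∃ b, RightBelow b f) ↔ ¬ (Odd f.row ∧ f.idx = 1) := by
  have hf := f.bounds
  rw [Nat.odd_iff]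
  constructor
  · rintro ⟨b, h1, h2⟩
    have hb := b.bounds
    omega
  · intro h
    obtain ⟨b, h1, h2⟩ := Particle.exists_of_bounds (n := n) (r := f.row - 1)
      (i := f.idx - f.row % 2) (by omega)
    exact ⟨b, by omega, by omega⟩

theorem exists_above_leftBelow_iff (f : Particle n) :
    (∃ b, LeftBelow b f) ↔ f.idx ≠ (f.row + 1) / 2 := by
  have hf := f.bounds
  constructor
  · rintro ⟨b, h1, h2⟩
    have hb := b.bounds
    rcases Nat.mod_two_eq_zero_or_one b.row with h | h <;> omega
  · intro h
    obtain ⟨b, h1, h2⟩ := Particle.exists_of_bounds (n := n) (r := f.row - 1)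
      (i := f.idx + (f.row - 1) % 2) (by omega)
    exact ⟨b, by omega, by omega⟩

theorem level_add_one {b f : Particle n} (h : f.row = b.row + 1) : b.level + 1 = f.level := by
  simp only [Particle.level, h]
  push_cast
  rfl

theorem sum_eq_ite {S : Type*} [Fintype S] (p : S → Prop) [DecidablePred p] (g : S → ℝ) (a : S)
    (h : ∀ b, p b → b = a) : (∑ b, if p b then g b else 0) = if p a then g a else 0 :=
  Finset.sum_eq_single a (fun b _ hb => if_neg fun h' => hb (h b h'))
    fun h' => absurd (Finset.mem_univ a) h'

-- For `LeftBelow b f`, the reversed move ending at `b` and the right jump of `f` are both possible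
-- exactly when `x f < x b`, and both carry the rate of the row of `f`. These pairs cancel. What
-- remains are the first particles of odd rows above row `n`, which have no such `f`, and the last
-- particle of every row, which has no such `b`.
open scoped Classical in
theorem sum_unblocked_right (q : ℕ → ℝ) (x : Pattern n) :
    (∑ b : Particle n, if b.row ≠ n ∧ 1 ≤ x.1 b ∧ ∀ f, LeftBelow b f → x.1 f < x.1 b
        then rowRate n q (b.level + 1) else 0) -
      ∑ a, (if RightBlocked x.1 a then 0 else rightRate q a) =
    (∑ b : Particle n, if b.row ≠ n ∧ 1 ≤ x.1 b ∧ Odd b.row ∧ b.idx = 1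
        then rowRate n q (b.level + 1) else 0) -
      ∑ a : Particle n, if a.idx = (a.row + 1) / 2 then rowRate n q a.level else 0 := by
  have h1 : ∀ b : Particle n,
      (if b.row ≠ n ∧ 1 ≤ x.1 b ∧ ∀ f, LeftBelow b f → x.1 f < x.1 b
        then rowRate n q (b.level + 1) else 0) =
      (∑ f, if LeftBelow b f ∧ x.1 f < x.1 b then rowRate n q f.level else 0) +
        if b.row ≠ n ∧ 1 ≤ x.1 b ∧ Odd b.row ∧ b.idx = 1 then rowRate n q (b.level + 1) else 0 := by
    intro b
    by_cases h : ∃ f, LeftBelow b f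
    · have h' := (exists_leftBelow_iff b).1 h
      obtain ⟨f, hf⟩ := h
      rw [sum_eq_ite _ _ f fun g hg => isStep_leftBelow.right_unique b g f hg.1 hf,
        if_neg (c := b.row ≠ n ∧ 1 ≤ x.1 b ∧ Odd b.row ∧ b.idx = 1) (fun h => h'.2 h.2.2),
        add_zero, level_add_one hf.1]
      refine if_congr ⟨fun h => ⟨hf, h.2.2 f hf⟩, fun h => ⟨h'.1, ?_, fun g hg => ?_⟩⟩ rfl rfl
      · have := x.2.nonneg f
        have := h.2
        omega
      · rw [isStep_leftBelow.right_unique b g f hg hf]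
        exact h.2
    · rw [Finset.sum_eq_zero fun f _ => if_neg fun h' => h ⟨f, h'.1⟩, zero_add]
      rw [exists_leftBelow_iff] at h
      refine if_congr ⟨fun h' => ⟨h'.1, h'.2.1, ?_⟩, fun h' => ⟨h'.1, h'.2.1, fun f hf => ?_⟩⟩ rfl rfl
      · by_contra h2
        exact h ⟨h'.1, h2⟩
      · exact absurd ((exists_leftBelow_iff b).1 ⟨f, hf⟩) h
  have h2 : ∀ f : Particle n, (if RightBlocked x.1 f then 0 else rightRate q f) =
      (∑ b, if LeftBelow b f ∧ x.1 f < x.1 b then rowRate n q f.level else 0) +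
        if f.idx = (f.row + 1) / 2 then rowRate n q f.level else 0 := by
    intro f
    rw [rightRate_eq]
    by_cases h : ∃ b, LeftBelow b f
    · have h' := (exists_above_leftBelow_iff f).1 h
      obtain ⟨b, hb⟩ := h
      rw [sum_eq_ite _ _ b fun g hg => isStep_leftBelow.left_unique g b f hg.1 hb,
        if_neg h', add_zero, ← ite_not]
      refine if_congr ⟨fun h => ⟨hb, ?_⟩, fun h => ?_⟩ rfl rfl
      · exact lt_of_le_of_ne (x.2.left_le b f hb) fun h3 => h ⟨b, hb, h3.symm⟩
      · rintro ⟨c, hc, h3⟩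
        rw [isStep_leftBelow.left_unique c b f hc hb] at h3
        exact h.2.ne h3.symm
    · rw [Finset.sum_eq_zero fun b _ => if_neg fun h' => h ⟨b, h'.1⟩, zero_add,
        if_neg fun ⟨c, hc, _⟩ => h ⟨c, hc⟩]
      rw [exists_above_leftBelow_iff, not_not] at h
      rw [if_pos h]
  simp_rw [h1, h2, Finset.sum_add_distrib]
  rw [Finset.sum_comm]
  ring

-- The same cancellation for `RightBelow b f`, with common condition `x b < x f`. Every particle
-- above row `n` has a right neighbour below, so only the left jumps of particles facing the wall
-- remain.
open scoped Classical in
theorem sum_unblocked_left (q : ℕ → ℝ) (x : Pattern n) :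
    (∑ b : Particle n, if b.row ≠ n ∧ ∀ f, RightBelow b f → x.1 b < x.1 f
        then (rowRate n q (b.level + 1))⁻¹ else 0) -
      ∑ a, (if LeftBlocked x.1 a then 0 else leftRate q a) =
    -∑ a : Particle n, if 1 ≤ x.1 a ∧ Odd a.row ∧ a.idx = 1 then (rowRate n q a.level)⁻¹ else 0 := by
  have h1 : ∀ b : Particle n, (if b.row ≠ n ∧ ∀ f, RightBelow b f → x.1 b < x.1 f
        then (rowRate n q (b.level + 1))⁻¹ else 0) =
      ∑ f, if RightBelow b f ∧ x.1 b < x.1 f then (rowRate n q f.level)⁻¹ else 0 := by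
    intro b
    by_cases h : b.row = n
    · rw [if_neg fun h' => h'.1 h, Finset.sum_eq_zero fun f _ => if_neg fun h' => ?_]
      have := f.bounds
      have := h'.1.1
      omega
    · obtain ⟨f, hf⟩ := exists_rightBelow h
      rw [sum_eq_ite _ _ f fun g hg => isStep_rightBelow.right_unique b g f hg.1 hf,
        level_add_one hf.1]
      refine if_congr ⟨fun h => ⟨hf, h.2 f hf⟩, fun h' => ⟨h, fun g hg => ?_⟩⟩ rfl rfl
      rw [isStep_rightBelow.right_unique b g f hg hf]
      exact h'.2
  have h2 : ∀ f : Particle n, (if LeftBlocked x.1 f then 0 else leftRate q f) =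
      (∑ b, if RightBelow b f ∧ x.1 b < x.1 f then (rowRate n q f.level)⁻¹ else 0) +
        if 1 ≤ x.1 f ∧ Odd f.row ∧ f.idx = 1 then (rowRate n q f.level)⁻¹ else 0 := by
    intro f
    rw [leftRate_eq, ← ite_not]
    by_cases h : ∃ b, RightBelow b f
    · have h' := (exists_rightBelow_iff f).1 h
      obtain ⟨b, hb⟩ := h
      rw [sum_eq_ite _ _ b fun g hg => isStep_rightBelow.left_unique g b f hg.1 hb,
        if_neg (c := 1 ≤ x.1 f ∧ Odd f.row ∧ f.idx = 1) fun h => h' h.2, add_zero]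
      refine if_congr ⟨fun h => ⟨hb, ?_⟩, fun h => ?_⟩ rfl rfl
      · exact lt_of_le_of_ne (x.2.le_right b f hb) fun h3 => h (Or.inr ⟨b, hb, h3⟩)
      · rintro (h3 | ⟨c, hc, h3⟩)
        · have := x.2.nonneg b
          have := h.2
          omega
        · rw [isStep_rightBelow.left_unique c b f hc hb] at h3
          exact h.2.ne h3
    · rw [Finset.sum_eq_zero fun b _ => if_neg fun h' => h ⟨b, h'.1⟩, zero_add]
      have h0 := x.2.nonneg f
      refine if_congr ⟨fun h' => ⟨?_, ?_⟩, fun h' => ?_⟩ rfl rfl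
      · have : x.1 f ≠ 0 := fun h3 => h' (Or.inl h3)
        omega
      · rwa [exists_rightBelow_iff, not_not] at h
      · rintro (h3 | ⟨c, hc, _⟩)
        · omega
        · exact h ⟨c, hc⟩
  simp_rw [h1, h2, Finset.sum_add_distrib]
  rw [Finset.sum_comm]
  ring

theorem sum_last (q : ℕ → ℝ) :
    (∑ a : Particle n, if a.idx = (a.row + 1) / 2 then rowRate n q a.level else 0) =
      ∑ r ∈ Finset.Icc 1 n, if Odd r then q ((r + 1) / 2) else (q ((r + 1) / 2))⁻¹ := by
  rw [← Finset.sum_filter]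
  refine Finset.sum_bij (fun a _ => a.row) ?_ ?_ ?_ ?_
  · intro a _
    exact Finset.mem_Icc.2 ⟨a.bounds.1, a.bounds.2.1⟩
  · intro a ha b hb h
    rw [Finset.mem_filter] at ha hb
    exact Particle.ext_row_idx h (by rw [ha.2, hb.2, h])
  · intro r hr
    have := Finset.mem_Icc.1 hr
    obtain ⟨a, h1, h2⟩ := Particle.exists_of_bounds (n := n) (r := r) (i := (r + 1) / 2) (by omega)
    exact ⟨a, by rw [Finset.mem_filter, h1, h2]; simp, h1⟩
  · intro a _
    rw [Particle.level, rowRate_natCast ⟨a.bounds.1, a.bounds.2.1⟩]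

theorem sum_Icc_two_mul (q : ℕ → ℝ) (k : ℕ) :
    (∑ r ∈ Finset.Icc 1 (2 * k), if Odd r then q ((r + 1) / 2) else (q ((r + 1) / 2))⁻¹) =
      ∑ i ∈ Finset.Icc 1 k, (q i + (q i)⁻¹) := by
  induction k with
  | zero => simp
  | succ k ih =>
    rw [show 2 * (k + 1) = 2 * k + 1 + 1 by ring, Finset.sum_Icc_succ_top (by omega),
      Finset.sum_Icc_succ_top (by omega), Finset.sum_Icc_succ_top (by omega), ih,
      if_pos (by simp), if_neg (by simp [Nat.even_add_one]),
      show (2 * k + 1 + 1) / 2 = k + 1 by omega, show (2 * k + 1 + 1 + 1) / 2 = k + 1 by omega]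
    ring

-- In row `2 i - 1`, the leftover gain from reversed right moves is the rate of row `2 i`, namely
-- `(q i)⁻¹`, and the leftover loss is the left rate towards the wall, also `(q i)⁻¹`. They cancel
-- unless the row is the bottom one, where there is no gain; this is the origin of the indicator in
-- the diagonal for odd `n`.
open scoped Classical in
theorem sum_wall (q : ℕ → ℝ) (x : Pattern n) :
    (∑ b : Particle n, if b.row ≠ n ∧ 1 ≤ x.1 b ∧ Odd b.row ∧ b.idx = 1
        then rowRate n q (b.level + 1) else 0) -
      (∑ a : Particle n, if 1 ≤ x.1 a ∧ Odd a.row ∧ a.idx = 1 then (rowRate n q a.level)⁻¹ else 0) =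
    -if Odd n ∧ ∃ i : Fin ((n + 1) / 2), (i : ℕ) = 0 ∧ 0 < (bottomRow x).1 i
      then (q ((n + 1) / 2))⁻¹ else 0 := by
  have h1 : ∀ b : Particle n, (if b.row ≠ n ∧ 1 ≤ x.1 b ∧ Odd b.row ∧ b.idx = 1
        then rowRate n q (b.level + 1) else 0) -
      (if 1 ≤ x.1 b ∧ Odd b.row ∧ b.idx = 1 then (rowRate n q b.level)⁻¹ else 0) =
      -if b.row = n ∧ 1 ≤ x.1 b ∧ Odd b.row ∧ b.idx = 1 then (q ((n + 1) / 2))⁻¹ else 0 := by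
    intro b
    have hb := b.bounds
    by_cases h : 1 ≤ x.1 b ∧ Odd b.row ∧ b.idx = 1
    · have e1 : rowRate n q b.level = q ((b.row + 1) / 2) := by
        rw [Particle.level, rowRate_natCast (by omega), if_pos h.2.1]
      rw [if_pos h, e1]
      by_cases hn : b.row = n
      · rw [if_neg fun h' => h'.1 hn, if_pos ⟨hn, h⟩, hn, zero_sub]
      · have e2 : rowRate n q (b.level + 1) = (q ((b.row + 1) / 2))⁻¹ := by
          have h2 := Nat.odd_iff.1 h.2.1
          have h3 : b.level + 1 = ((b.row + 1 : ℕ) : ℤ) := by simp [Particle.level]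
          rw [h3, rowRate_natCast (by omega), if_neg (by rw [Nat.odd_iff]; omega),
            show (b.row + 1 + 1) / 2 = (b.row + 1) / 2 by omega]
        rw [if_pos ⟨hn, h⟩, if_neg fun h' => hn h'.1, e2, sub_self, neg_zero]
    · rw [if_neg fun h' => h h'.2, if_neg h, if_neg fun h' => h h'.2, sub_zero, neg_zero]
  rw [← Finset.sum_sub_distrib, Finset.sum_congr rfl fun b _ => h1 b, Finset.sum_neg_distrib]
  congr 1
  by_cases h : Odd n ∧ ∃ i : Fin ((n + 1) / 2), (i : ℕ) = 0 ∧ 0 < (bottomRow x).1 i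
  · obtain ⟨hn, i, hi, hx⟩ := id h
    rw [if_pos h, sum_eq_ite _ _ (bottomParticle n i) fun b hb => Particle.ext_row_idx hb.1 (by
      rw [hb.2.2.2, idx_bottomParticle, hi]), if_pos]
    exact ⟨rfl, hx, hn, by rw [idx_bottomParticle, hi]⟩
  · rw [if_neg h]
    refine Finset.sum_eq_zero fun b _ => if_neg ?_
    rintro ⟨hb, hx, ho, hi⟩
    obtain ⟨i, rfl⟩ := exists_eq_bottomParticle hb
    rw [idx_bottomParticle] at hi
    exact h ⟨ho, i, by omega, hx⟩

open scoped Classical in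
theorem rowQ_self (hn : 1 ≤ n) (q : ℕ → ℝ) (z : Chamber ((n + 1) / 2)) :
    rowQ n q z z = -(∑ r ∈ Finset.Icc 1 n, if Odd r then q ((r + 1) / 2) else (q ((r + 1) / 2))⁻¹) -
      if Odd n ∧ ∃ i : Fin ((n + 1) / 2), (i : ℕ) = 0 ∧ 0 < z.1 i
        then (q ((n + 1) / 2))⁻¹ else 0 := by
  rw [rowQ, if_pos rfl]
  by_cases h : Odd n
  · rw [if_pos h]
    simp only [h, true_and]
    obtain ⟨k, rfl⟩ := id h
    rw [Finset.sum_Icc_succ_top (by omega), sum_Icc_two_mul, if_pos h,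
      show (2 * k + 1 + 1) / 2 - 1 = k by omega]
    ring
  · rw [if_neg h, if_neg fun h' => h h'.1, sub_zero]
    obtain ⟨k, hk⟩ := Nat.not_odd_iff_even.1 h
    obtain rfl : n = 2 * k := by omega
    rw [sum_Icc_two_mul, show (2 * k + 1) / 2 = k by omega]

-- Since adding or subtracting a basis vector changes the bottom row, only chains ending above row
-- `n` occur, and the three cancellation lemmas account for all of them.
open scoped Classical in
theorem sum_unpush_self (hn : 1 ≤ n) (q : ℕ → ℝ) (x : Pattern n) :
    patternQ n q x x +
      ((∑ b, if ∃ y, bottomRow y = bottomRow x ∧ y.1 = unpush RightBelow x.1 b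
          then rowRate n q (b.level + 1) else 0) +
        ∑ b, if ∃ y, bottomRow y = bottomRow x ∧ y.1 = -unpush LeftBelow (-x.1) b
          then (rowRate n q (b.level + 1))⁻¹ else 0) =
    rowQ n q (bottomRow x) (bottomRow x) := by
  have hzero : ∀ i : Fin ((n + 1) / 2), (Pi.single i 1 : Fin ((n + 1) / 2) → ℤ) ≠ 0 := fun i h => by
    have := congrFun h i
    simp at this
  have hR : ∀ b, (∃ y, bottomRow y = bottomRow x ∧ y.1 = unpush RightBelow x.1 b) ↔
      b.row ≠ n ∧ 1 ≤ x.1 b ∧ ∀ f, LeftBelow b f → x.1 f < x.1 b := by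
    intro b
    by_cases hb : b.row = n
    · obtain ⟨i, rfl⟩ := exists_eq_bottomParticle hb
      rw [exists_unpush_right_bottom_iff, left_eq_add]
      exact ⟨fun h => absurd h (hzero i), fun h => absurd hb h.1⟩
    · rw [exists_unpush_right_iff hb]
      simp [hb]
  have hL : ∀ b, (∃ y, bottomRow y = bottomRow x ∧ y.1 = -unpush LeftBelow (-x.1) b) ↔
      b.row ≠ n ∧ ∀ f, RightBelow b f → x.1 b < x.1 f := by
    intro b
    by_cases hb : b.row = n
    · obtain ⟨i, rfl⟩ := exists_eq_bottomParticle hb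
      rw [exists_unpush_left_bottom_iff, eq_comm, sub_eq_self]
      exact ⟨fun h => absurd h (hzero i), fun h => absurd hb h.1⟩
    · rw [exists_unpush_left_iff hb]
      simp [hb]
  have h1 := sum_unblocked_right q x
  have h2 := sum_unblocked_left q x
  have h3 := sum_wall q x
  have eR : (∑ b, if ∃ y, bottomRow y = bottomRow x ∧ y.1 = unpush RightBelow x.1 b
      then rowRate n q (b.level + 1) else 0) =
        ∑ b : Particle n, if b.row ≠ n ∧ 1 ≤ x.1 b ∧ ∀ f, LeftBelow b f → x.1 f < x.1 b
          then rowRate n q (b.level + 1) else 0 :=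
    Finset.sum_congr rfl fun b _ => if_congr (hR b) rfl rfl
  have eL : (∑ b, if ∃ y, bottomRow y = bottomRow x ∧ y.1 = -unpush LeftBelow (-x.1) b
      then (rowRate n q (b.level + 1))⁻¹ else 0) =
        ∑ b : Particle n, if b.row ≠ n ∧ ∀ f, RightBelow b f → x.1 b < x.1 f
          then (rowRate n q (b.level + 1))⁻¹ else 0 :=
    Finset.sum_congr rfl fun b _ => if_congr (hL b) rfl rfl
  rw [eR, eL, rowQ_self hn, patternQ, if_pos rfl, Finset.sum_add_distrib, ← sum_last]
  linarith

/-! ### The intertwining relation and the conclusion -/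

open scoped Classical in
theorem sum_fiber_weight_mul (hn : 1 ≤ n) (hq : ∀ i, 1 ≤ i → i ≤ (n + 1) / 2 → 0 < q i)
    (z : Chamber ((n + 1) / 2)) (x : Pattern n) :
    ∑ y ∈ fiber z, weight q y * patternQ n q y x =
      rowQ n q z (bottomRow x) * (weight q x / Sp n q (bottomRow x)) * Sp n q z := by
  have h : ∑ y ∈ fiber z, weight q y * patternQ n q y x =
      weight q x * ((if bottomRow x = z then patternQ n q x x else 0) +
      ((∑ b, if ∃ y, bottomRow y = z ∧ y.1 = unpush RightBelow x.1 b
          then rowRate n q (b.level + 1) else 0) +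
        ∑ b, if ∃ y, bottomRow y = z ∧ y.1 = -unpush LeftBelow (-x.1) b
          then (rowRate n q (b.level + 1))⁻¹ else 0)) := by
    rw [Finset.sum_congr rfl fun y _ => congrArg (weight q y * ·) (patternQ_eq q y x)]
    simp only [mul_add, Finset.sum_add_distrib, sum_fiber_jumpRight hq, sum_fiber_jumpLeft hq]
    congr 1
    by_cases hz : bottomRow x = z
    · rw [if_pos hz, Finset.sum_eq_single x, if_pos rfl]
      · exact fun y _ hy => by rw [if_neg hy, mul_zero]
      · exact fun h => absurd (mem_fiber.2 hz) h
    · rw [if_neg hz, mul_zero]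
      refine Finset.sum_eq_zero fun y hy => ?_
      rw [if_neg, mul_zero]
      rintro rfl
      exact hz (mem_fiber.1 hy)
  rw [h]
  have h0 := fun w => (sp_pos (n := n) hq w).ne'
  -- On the diagonal the two symplectic Schur functions cancel; off the diagonal their ratio is
  -- absorbed by the entry of `rowQ`, leaving `weight q x` times an indicator.
  by_cases hz : bottomRow x = z
  · subst hz
    rw [if_pos rfl, sum_unpush_self hn]
    field_simp [h0]
  · rw [if_neg hz, zero_add, sum_unpush_of_ne hz, rowQ, if_neg (Ne.symm hz)]
    split_ifs
    · field_simp [h0]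
    · ring

theorem isIntertwining (hn : 1 ≤ n) (hq : ∀ i, 1 ≤ i → i ≤ (n + 1) / 2 → 0 < q i) :
    IsIntertwining (patternQ n q) (rowQ n q) bottomRow (initialLaw n q) where
  nonneg := initialLaw_nonneg hq
  hasSum_one := hasSum_initialLaw hq
  eq_zero z x h := if_neg h
  comm z x := by
    have h := hasSum_initialLaw_mul q z fun y => patternQ n q y x
    rw [sum_fiber_weight_mul hn hq, mul_div_cancel_right₀ _ (sp_pos hq z).ne'] at h
    rwa [initialLaw, if_pos rfl]

theorem isConservative_rowQ (hn : 1 ≤ n) (hq : ∀ i, 1 ≤ i → i ≤ (n + 1) / 2 → 0 < q i) :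
    IsConservative (rowQ n q) where
  nonneg x y h := by
    rw [rowQ, if_neg h]
    split_ifs
    exacts [div_nonneg (sp_pos hq y).le (sp_pos hq x).le, le_rfl]
  hasSum_zero := (isIntertwining hn hq).hasSum_zero (isConservative_patternQ hq)
    (neg_patternQ_self_le hq)

theorem neg_rowQ_self_le (hn : 1 ≤ n) (hq : ∀ i, 1 ≤ i → i ≤ (n + 1) / 2 → 0 < q i)
    (z : Chamber ((n + 1) / 2)) :
    -rowQ n q z z ≤
      (∑ r ∈ Finset.Icc 1 n, if Odd r then q ((r + 1) / 2) else (q ((r + 1) / 2))⁻¹) +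
        (q ((n + 1) / 2))⁻¹ := by
  have h := (inv_pos.2 (hq ((n + 1) / 2) (by omega) le_rfl)).le
  rw [rowQ_self hn, neg_sub, sub_neg_eq_add, add_comm]
  gcongr
  split_ifs
  exacts [le_rfl, h]

end SymplecticGT

open scoped Classical in
theorem theorem3 (n : ℕ) (hn : 1 ≤ n) (q : ℕ → ℝ)
    (hq : ∀ i, 1 ≤ i → i ≤ (n + 1) / 2 → 0 < q i ∧ q i < 1) :
    SymplecticGT.IsConservative (SymplecticGT.rowQ n q) ∧
    ∀ (z : SymplecticGT.Chamber ((n + 1) / 2)) (Ω : Type*) [MeasurableSpace Ω]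
      (μ : MeasureTheory.Measure Ω) [MeasureTheory.IsProbabilityMeasure μ]
      (X : ℝ≥0 → Ω → SymplecticGT.Pattern n),
      SymplecticGT.IsMarkovProcess μ X (SymplecticGT.patternQ n q)
        (SymplecticGT.initialLaw n q z) →
      SymplecticGT.IsMarkovProcess μ (fun t ω => SymplecticGT.bottomRow (X t ω))
        (SymplecticGT.rowQ n q) (fun w => if w = z then 1 else 0) := by
  have hq' : ∀ i, 1 ≤ i → i ≤ (n + 1) / 2 → 0 < q i := fun i h1 h2 => (hq i h1 h2).1
  refine ⟨SymplecticGT.isConservative_rowQ hn hq', fun z Ω _ μ _ X hX => ?_⟩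
  exact SymplecticGT.IsMarkovProcess.of_isIntertwining (SymplecticGT.isIntertwining hn hq')
    (SymplecticGT.isConservative_patternQ hq') (SymplecticGT.neg_patternQ_self_le hq')
    (SymplecticGT.isConservative_rowQ hn hq') (SymplecticGT.neg_rowQ_self_le hn hq') hX
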